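/- All vector spaces are over $\mathbb{C}$. Let $m,n\ge 0$ and let $M=2m+1$ or $M=2m$. Let $\mathfrak{osp}(M|2n)$ be the Lie superalgebra of the linear transformations of the superspace $\mathbb{C}^{M|2n}$ (even part of dimension $M$, odd part of dimension $2n$) preserving a non-degenerate even supersymmetric bilinear form, i.e. the sums of homogeneous $X$ with $(Xv|w)+(-1)^{|X||v|}(v|Xw)=0$. Let $\mathfrak{h}$ be its standard diagonal Cartan subalgebra, and let $\pm\delta_i$ $(1\le i\le n)$, $\pm\varepsilon_j$ $(1\le j\le m)$, together with $0$ if $M$ is odd, be the weights of $\mathbb{C}^{M|2n}$. Highest weights are taken with respect to the standard Borel subalgebra, i.e. the one containing $\mathfrak{h}$ whose positive roots are $\delta_i\pm\delta_j$ $(i<j)$, $2\delta_i$, $\delta_i\pm\varepsilon_j$, $\varepsilon_i\pm\varepsilon_j$ $(i<j)$, and in addition $\delta_i$ and $\varepsilon_j$ if $M$ is odd. A weight is called integral if it lies in the $\mathbb{Z}$-span of the $\delta_i$ and $\varepsilon_j$. Modules are $\mathbb{Z}/2$-graded. A module $V$ is called self-contragredient if it is isomorphic, by an even isomorphism, to its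 contragredient (dual) module $V^*$, on which $(xf)(v)=-(-1)^{|x||f|}f(xv)$ for homogeneous $x$ and $f$. (1) For all $m,n\ge 0$, every finite dimensional irreducible $\mathfrak{osp}(2m+1|2n)$-module of integral highest weight is self-contragredient. (2) For all $m,n\ge 0$ with $m$ even, every finite dimensional irreducible $\mathfrak{osp}(2m|2n)$-module of integral highest weight is self-contragredient. -/

import Mathlib

noncomputable section

/-! ### Lie superalgebras, their modules and contragredient modules -/

/-- The sign `(-1)^(i j)`. -/
def koszulSign (i j : ZMod 2) : ℂ := if i = 1 ∧ j = 1 then -1 else 1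

theorem zmod2_cases (i : ZMod 2) : i = 0 ∨ i = 1 := by revert i; decide

theorem zmod2_one_add_one : (1 : ZMod 2) + 1 = 0 := by decide

theorem zmod2_eq_add_one {i j : ZMod 2} (h : ¬i = j) : j = i + 1 := by revert i j; decide

/-- A `ℤ/2`-grading `V = V₀ ⊕ V₁` of a complex vector space. -/
structure SuperSpace (V : Type*) [AddCommGroup V] [Module ℂ V] where
  part : ZMod 2 → Submodule ℂ V
  isCompl_part : IsCompl (part 0) (part 1)

namespace SuperSpace

variable {V : Type*} [AddCommGroup V] [Module ℂ V] (S : SuperSpace V)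

theorem isCompl_part_add_one (i : ZMod 2) : IsCompl (S.part i) (S.part (i + 1)) := by
  fin_cases i
  · exact S.isCompl_part
  · exact S.isCompl_part.symm

/-- The projection of `V = V₀ ⊕ V₁` onto `Vᵢ`, as an endomorphism of `V`. -/
def proj (i : ZMod 2) : V →ₗ[ℂ] V := Submodule.projection _ _ (S.isCompl_part_add_one i)

theorem proj_mem (i : ZMod 2) (v : V) : S.proj i v ∈ S.part i :=
  Submodule.projection_apply_mem _ v

theorem proj_of_mem {i j : ZMod 2} {v : V} (hv : v ∈ S.part j) :
    S.proj i v = if i = j then v else 0 := by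
  split_ifs with h
  · subst h
    exact Submodule.projection_apply_left _ ⟨v, hv⟩
  · have hj : j = i + 1 := zmod2_eq_add_one h
    subst hj
    exact Submodule.projection_apply_right _ ⟨v, hv⟩

theorem sum_proj (v : V) : S.proj 0 v + S.proj 1 v = v := by
  have hv : v ∈ S.part 0 ⊔ S.part 1 := S.isCompl_part.sup_eq_top ▸ Submodule.mem_top
  obtain ⟨a, ha, b, hb, rfl⟩ := Submodule.mem_sup.1 hv
  simp [S.proj_of_mem ha, S.proj_of_mem hb]

end SuperSpace

/-- A Lie superalgebra over `ℂ`. -/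
class LieSuperalgebra (𝔤 : Type*) [AddCommGroup 𝔤] [Module ℂ 𝔤] extends SuperSpace 𝔤 where
  /-- the superbracket `[x, y]` -/
  sbr : 𝔤 →ₗ[ℂ] 𝔤 →ₗ[ℂ] 𝔤
  sbr_mem : ∀ {i j : ZMod 2} {x y : 𝔤}, x ∈ part i → y ∈ part j → sbr x y ∈ part (i + j)
  sbr_skew : ∀ {i j : ZMod 2} {x y : 𝔤}, x ∈ part i → y ∈ part j →
    sbr x y = -(koszulSign i j • sbr y x)
  sbr_jacobi : ∀ {i j : ZMod 2} {x y : 𝔤}, x ∈ part i → y ∈ part j → ∀ z : 𝔤,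
    sbr x (sbr y z) = sbr (sbr x y) z + koszulSign i j • sbr y (sbr x z)

/-- A (`ℤ/2`-graded) module structure over the Lie superalgebra `𝔤` on the vector space `V`. -/
structure SuperRep (𝔤 : Type*) [AddCommGroup 𝔤] [Module ℂ 𝔤] [LieSuperalgebra 𝔤]
    (V : Type*) [AddCommGroup V] [Module ℂ V] extends SuperSpace V where
  /-- the action of `𝔤` on `V` -/
  act : 𝔤 →ₗ[ℂ] V →ₗ[ℂ] V
  act_mem : ∀ {i j : ZMod 2} {x : 𝔤} {v : V},
    x ∈ LieSuperalgebra.toSuperSpace.part i → v ∈ part j → act x v ∈ part (i + j)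
  act_sbr : ∀ {i j : ZMod 2} {x y : 𝔤},
    x ∈ LieSuperalgebra.toSuperSpace.part i → y ∈ LieSuperalgebra.toSuperSpace.part j →
    ∀ v : V, act (LieSuperalgebra.sbr x y) v = act x (act y v) - koszulSign i j • act y (act x v)

namespace SuperRep

variable {𝔤 : Type*} [AddCommGroup 𝔤] [Module ℂ 𝔤] [LieSuperalgebra 𝔤]
variable {V : Type*} [AddCommGroup V] [Module ℂ V]
variable {W : Type*} [AddCommGroup W] [Module ℂ W]

/-- Irreducibility: `V ≠ 0`, and the only graded submodules of `V` are `0` and `V`. -/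
def IsIrreducible (ρ : SuperRep 𝔤 V) : Prop :=
  Nontrivial V ∧ ∀ U : Submodule ℂ V,
    (∀ i : ZMod 2, ∀ v ∈ U, ρ.proj i v ∈ U) → (∀ x : 𝔤, ∀ v ∈ U, ρ.act x v ∈ U) →
      U = ⊥ ∨ U = ⊤

/-- Isomorphism of `𝔤`-modules by an even map. -/
def IsIsomorphic (ρ : SuperRep 𝔤 V) (σ : SuperRep 𝔤 W) : Prop :=
  ∃ e : V ≃ₗ[ℂ] W, (∀ i : ZMod 2, ∀ v ∈ ρ.part i, e v ∈ σ.part i) ∧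
    ∀ (x : 𝔤) (v : V), e (ρ.act x v) = σ.act x (e v)

/-- The action on `V*`, by `(x f)(v) = -(-1)^(i j) f (x v)` for homogeneous `x` and `f` of
degrees `i` and `j`, extended bilinearly. -/
def dualAct (ρ : SuperRep 𝔤 V) : 𝔤 →ₗ[ℂ] Module.Dual ℂ V →ₗ[ℂ] Module.Dual ℂ V :=
  LinearMap.mk₂ ℂ
    (fun x f => -∑ i : ZMod 2, ∑ j : ZMod 2, koszulSign i j •
      ((f ∘ₗ ρ.proj j) ∘ₗ ρ.act (LieSuperalgebra.toSuperSpace.proj i x)))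
    (by
      intros
      simp only [map_add, LinearMap.comp_add, smul_add, Finset.sum_add_distrib, neg_add])
    (by
      intro c x f
      simp only [map_smul, LinearMap.comp_smul, Finset.smul_sum, smul_neg, smul_comm c])
    (by
      intros
      simp only [LinearMap.add_comp, smul_add, Finset.sum_add_distrib, neg_add])
    (by
      intro c x f
      simp only [LinearMap.smul_comp, Finset.smul_sum, smul_neg, smul_comm c])

/-- A functional of degree `j` is one that vanishes on the part of degree `j + 1`. -/
theorem dualAct_apply (ρ : SuperRep 𝔤 V) {i j : ZMod 2} {x : 𝔤} {f : Module.Dual ℂ V}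
    (hx : x ∈ LieSuperalgebra.toSuperSpace.part i)
    (hf : f ∈ (ρ.part (j + 1)).dualAnnihilator) (v : V) :
    ρ.dualAct x f v = -(koszulSign i j * f (ρ.act x v)) := by
  have hfz : ∀ w, f (ρ.proj (j + 1) w) = 0 := fun w =>
    (Submodule.mem_dualAnnihilator f).1 hf _ (ρ.proj_mem _ w)
  have hfj : ∀ w, f (ρ.proj j w) = f w := fun w => by
    have h := congrArg f (ρ.sum_proj w)
    rw [map_add] at h
    rw [← h]
    have h0 := hfz w
    rcases zmod2_cases j with rfl | rfl
    · simpa using h0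
    · simpa [zmod2_one_add_one] using h0
  have h1 : ∀ k w, f (ρ.proj k w) = if k = j then f w else 0 := fun k w => by
    split_ifs with h
    · rw [h, hfj]
    · have : k = j + 1 := zmod2_eq_add_one (Ne.symm h)
      rw [this, hfz]
  have h2 : ∀ k, LieSuperalgebra.toSuperSpace.proj k x = if k = i then x else 0 :=
    fun k => SuperSpace.proj_of_mem _ hx
  simp only [dualAct, LinearMap.mk₂_apply, LinearMap.neg_apply, LinearMap.sum_apply,
    LinearMap.smul_apply, LinearMap.comp_apply, h1, h2, smul_eq_mul]
  rw [Finset.sum_eq_single i, Finset.sum_eq_single j]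
  · simp
  · intro b _ hb; simp [hb]
  · simp
  · intro b _ hb; simp [hb]
  · simp

theorem dualAct_mem (ρ : SuperRep 𝔤 V) {i j : ZMod 2} {x : 𝔤} {f : Module.Dual ℂ V}
    (hx : x ∈ LieSuperalgebra.toSuperSpace.part i)
    (hf : f ∈ (ρ.part (j + 1)).dualAnnihilator) :
    ρ.dualAct x f ∈ (ρ.part (i + j + 1)).dualAnnihilator := by
  rw [Submodule.mem_dualAnnihilator]
  intro v hv
  rw [ρ.dualAct_apply hx hf]
  have h := ρ.act_mem hx hv
  have e : i + (i + j + 1) = j + 1 := by clear h hf hx hv; revert i j; decide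
  rw [e] at h
  rw [(Submodule.mem_dualAnnihilator f).1 hf _ h]
  simp

/-- The contragredient (dual) module `V*`. -/
def contragredient (ρ : SuperRep 𝔤 V) : SuperRep 𝔤 (Module.Dual ℂ V) where
  part j := (ρ.part (j + 1)).dualAnnihilator
  isCompl_part := Subspace.isCompl_dualAnnihilator (ρ.isCompl_part_add_one (0 + 1))
  act := ρ.dualAct
  act_mem hx hf := ρ.dualAct_mem hx hf
  act_sbr := by
    intro i j x y hx hy f
    have key : ∀ k : ZMod 2, ∀ f ∈ (ρ.part (k + 1)).dualAnnihilator,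
        ρ.dualAct (LieSuperalgebra.sbr x y) f =
          ρ.dualAct x (ρ.dualAct y f) - koszulSign i j • ρ.dualAct y (ρ.dualAct x f) := by
      intro k f hf
      ext v
      rw [ρ.dualAct_apply (LieSuperalgebra.sbr_mem hx hy) hf, LinearMap.sub_apply,
        LinearMap.smul_apply, ρ.dualAct_apply hx (ρ.dualAct_mem hy hf),
        ρ.dualAct_apply hy (ρ.dualAct_mem hx hf), ρ.dualAct_apply hx hf,
        ρ.dualAct_apply hy hf, ρ.act_sbr hx hy]
      simp only [map_sub, map_smul, smul_eq_mul]
      rcases zmod2_cases i with rfl | rfl <;> rcases zmod2_cases j with rfl | rfl <;>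
        rcases zmod2_cases k with rfl | rfl <;>
        simp [koszulSign, zmod2_one_add_one] <;> ring
    have hs : f ∈ (ρ.part (0 + 1)).dualAnnihilator ⊔ (ρ.part (1 + 1)).dualAnnihilator := by
      have h := (Subspace.isCompl_dualAnnihilator (ρ.isCompl_part_add_one (0 + 1))).sup_eq_top
      exact h ▸ Submodule.mem_top
    obtain ⟨a, ha, b, hb, rfl⟩ := Submodule.mem_sup.1 hs
    simp only [map_add, key 0 a ha, key 1 b hb, smul_add]
    abel

/-- `V` is self-contragredient if it is isomorphic to its contragredient module. -/
def IsSelfContragredient (ρ : SuperRep 𝔤 V) : Prop :=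
  ρ.IsIsomorphic ρ.contragredient

end SuperRep

/-! ### The Lie superalgebra of a bilinear form -/

section PreservingForm

variable {ι : Type*} [Fintype ι] [DecidableEq ι] (p : ι → ZMod 2)

/-- The matrices of degree `i`, when the `a`-th basis vector has parity `p a`. -/
def glPart (i : ZMod 2) : Submodule ℂ (Matrix ι ι ℂ) where
  carrier := {X | ∀ a b, p a ≠ p b + i → X a b = 0}
  zero_mem' := fun _ _ _ => rfl
  add_mem' := fun hX hY a b h => by simp [hX a b h, hY a b h]
  smul_mem' := fun c X hX a b h => by simp [hX a b h]

/-- The component of degree `i` of a matrix. -/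
def glProj (i : ZMod 2) : Matrix ι ι ℂ →ₗ[ℂ] Matrix ι ι ℂ where
  toFun X := Matrix.of fun a b => if p a = p b + i then X a b else 0
  map_add' X Y := by ext a b; simp only [Matrix.of_apply, Matrix.add_apply]; split_ifs <;> simp
  map_smul' c X := by
    ext a b; simp only [Matrix.of_apply, Matrix.smul_apply, RingHom.id_apply]; split_ifs <;> simp

/-- The supercommutator: `X Y - (-1)^(i j) Y X` for `X`, `Y` of degrees `i`, `j`, extended
bilinearly. -/
def superComm : Matrix ι ι ℂ →ₗ[ℂ] Matrix ι ι ℂ →ₗ[ℂ] Matrix ι ι ℂ :=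
  LinearMap.mk₂ ℂ
    (fun X Y => X * Y - ∑ i : ZMod 2, ∑ j : ZMod 2,
      koszulSign i j • (glProj p j Y * glProj p i X))
    (by intros; simp only [map_add, add_mul, mul_add, smul_add, Finset.sum_add_distrib]; abel)
    (by
      intro c X Y
      simp only [map_smul, Matrix.smul_mul, Matrix.mul_smul, smul_sub, Finset.smul_sum,
        smul_comm c])
    (by intros; simp only [map_add, add_mul, mul_add, smul_add, Finset.sum_add_distrib]; abel)
    (by
      intro c X Y
      simp only [map_smul, Matrix.smul_mul, Matrix.mul_smul, smul_sub, Finset.smul_sum,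
        smul_comm c])

/-- The matrices `X` of degree `i` with `(X v | w) + (-1)^(i |v|) (v | X w) = 0` for all basis
vectors `v`, `w`, where `B` is the Gram matrix of the form `(· | ·)`. -/
def formPart (B : Matrix ι ι ℂ) (i : ZMod 2) : Submodule ℂ (Matrix ι ι ℂ) where
  carrier := {X | X ∈ glPart p i ∧
    ∀ a b, (X.transpose * B) a b + koszulSign i (p a) * (B * X) a b = 0}
  zero_mem' := ⟨zero_mem _, fun a b => by simp⟩
  add_mem' := fun {X Y} hX hY => ⟨add_mem hX.1 hY.1, fun a b => by
    have h1 := hX.2 a b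
    have h2 := hY.2 a b
    simp only [Matrix.transpose_add, Matrix.add_mul, Matrix.mul_add, Matrix.add_apply]
    linear_combination h1 + h2⟩
  smul_mem' := fun c X hX => ⟨Submodule.smul_mem _ c hX.1, fun a b => by
    have h1 := hX.2 a b
    simp only [Matrix.transpose_smul, Matrix.smul_mul, Matrix.mul_smul, Matrix.smul_apply,
      smul_eq_mul]
    linear_combination c * h1⟩

/-- The matrices preserving the form with Gram matrix `B`: sums of an even and an odd one. -/
def preservingForm (B : Matrix ι ι ℂ) : Submodule ℂ (Matrix ι ι ℂ) :=
  formPart p B 0 ⊔ formPart p B 1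

variable {p}

theorem glProj_of_mem {i j : ZMod 2} {X : Matrix ι ι ℂ} (hX : X ∈ glPart p j) :
    glProj p i X = if i = j then X else 0 := by
  ext a b
  change (if p a = p b + i then X a b else 0) = _
  split_ifs with h1 h2 h2
  · rfl
  · apply hX a b
    rw [h1]
    simpa using h2
  · subst h2
    exact (hX a b h1).symm
  · rfl

theorem superComm_apply {i j : ZMod 2} {X Y : Matrix ι ι ℂ} (hX : X ∈ glPart p i)
    (hY : Y ∈ glPart p j) : superComm p X Y = X * Y - koszulSign i j • (Y * X) := by
  simp only [superComm, LinearMap.mk₂_apply, glProj_of_mem hX, glProj_of_mem hY]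
  rw [Finset.sum_eq_single i, Finset.sum_eq_single j]
  · simp
  · intro b _ hb; simp [hb]
  · simp
  · intro b _ hb; simp [hb]
  · simp

theorem mul_mem_glPart {i j : ZMod 2} {X Y : Matrix ι ι ℂ} (hX : X ∈ glPart p i)
    (hY : Y ∈ glPart p j) : X * Y ∈ glPart p (i + j) := by
  intro a b h
  rw [Matrix.mul_apply]
  refine Finset.sum_eq_zero fun c _ => ?_
  by_cases h1 : p a = p c + i
  · rw [hY c b, mul_zero]
    intro h2
    apply h
    rw [h1, h2]
    ring
  · rw [hX a c h1, zero_mul]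

theorem superComm_mem_glPart {i j : ZMod 2} {X Y : Matrix ι ι ℂ} (hX : X ∈ glPart p i)
    (hY : Y ∈ glPart p j) : superComm p X Y ∈ glPart p (i + j) := by
  rw [superComm_apply hX hY]
  exact sub_mem (mul_mem_glPart hX hY)
    (Submodule.smul_mem _ _ (add_comm i j ▸ mul_mem_glPart hY hX))

variable {B : Matrix ι ι ℂ}

theorem mem_formPart_iff {i : ZMod 2} {X : Matrix ι ι ℂ} :
    X ∈ formPart p B i ↔ X ∈ glPart p i ∧
      X.transpose * B = -(Matrix.diagonal (fun a => koszulSign i (p a)) * (B * X)) := by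
  refine and_congr_right fun _ => ?_
  rw [← Matrix.ext_iff]
  refine forall₂_congr fun a b => ?_
  rw [Matrix.neg_apply, Matrix.diagonal_mul, eq_neg_iff_add_eq_zero]

theorem formPart_prod {i j : ZMod 2} {X Y : Matrix ι ι ℂ} (hX : X ∈ formPart p B i)
    (hY : Y ∈ formPart p B j) :
    (X * Y).transpose * B = koszulSign i j •
      (Matrix.diagonal (fun a => koszulSign (i + j) (p a)) * (B * (Y * X))) := by
  have h1 := (mem_formPart_iff.1 hX).2
  have h2 := (mem_formPart_iff.1 hY).2
  have h3 : Y.transpose * Matrix.diagonal (fun a => koszulSign i (p a)) =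
      koszulSign i j • (Matrix.diagonal (fun a => koszulSign i (p a)) * Y.transpose) := by
    ext a b
    rw [Matrix.mul_diagonal, Matrix.smul_apply, Matrix.diagonal_mul, Matrix.transpose_apply]
    by_cases h : p b = p a + j
    · rw [h]
      have : koszulSign i (p a + j) = koszulSign i j * koszulSign i (p a) := by
        generalize p a = k
        rcases zmod2_cases i with rfl | rfl <;> rcases zmod2_cases j with rfl | rfl <;>
        rcases zmod2_cases k with rfl | rfl <;> simp [koszulSign, zmod2_one_add_one]
      rw [this, smul_eq_mul]
      ring
    · rw [hY.1 b a h]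
      simp
  have h4 : Matrix.diagonal (fun a => koszulSign i (p a)) *
      Matrix.diagonal (fun a => koszulSign j (p a)) =
      Matrix.diagonal (fun a => koszulSign (i + j) (p a)) := by
    rw [Matrix.diagonal_mul_diagonal]
    congr 1
    funext a
    generalize p a = k
    rcases zmod2_cases i with rfl | rfl <;> rcases zmod2_cases j with rfl | rfl <;>
        rcases zmod2_cases k with rfl | rfl <;> simp [koszulSign, zmod2_one_add_one]
  rw [Matrix.transpose_mul, Matrix.mul_assoc, h1, Matrix.mul_neg, ← Matrix.mul_assoc, h3,
    Matrix.smul_mul, Matrix.mul_assoc, ← Matrix.mul_assoc _ B, h2, Matrix.neg_mul,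
    Matrix.mul_neg, ← h4]
  simp only [Matrix.mul_assoc, smul_neg, neg_neg]

theorem superComm_mem_formPart {i j : ZMod 2} {X Y : Matrix ι ι ℂ} (hX : X ∈ formPart p B i)
    (hY : Y ∈ formPart p B j) : superComm p X Y ∈ formPart p B (i + j) := by
  rw [mem_formPart_iff]
  refine ⟨superComm_mem_glPart hX.1 hY.1, ?_⟩
  have hs : koszulSign i j * koszulSign j i = 1 := by
    rcases zmod2_cases i with rfl | rfl <;> rcases zmod2_cases j with rfl | rfl <;>
       simp [koszulSign, zmod2_one_add_one]
  rw [superComm_apply hX.1 hY.1, Matrix.transpose_sub, Matrix.transpose_smul, Matrix.sub_mul,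
    Matrix.smul_mul, formPart_prod hX hY, formPart_prod hY hX, smul_smul, hs, add_comm j i]
  simp only [Matrix.mul_sub, Matrix.mul_smul, one_smul]
  abel

theorem formPart_le (i : ZMod 2) : formPart p B i ≤ preservingForm p B := by
  fin_cases i
  · exact le_sup_left
  · exact le_sup_right

theorem superComm_mem_preservingForm {X Y : Matrix ι ι ℂ} (hX : X ∈ preservingForm p B)
    (hY : Y ∈ preservingForm p B) : superComm p X Y ∈ preservingForm p B := by
  obtain ⟨a, ha, b, hb, rfl⟩ := Submodule.mem_sup.1 hX
  obtain ⟨c, hc, d, hd, rfl⟩ := Submodule.mem_sup.1 hY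
  simp only [map_add, LinearMap.add_apply]
  exact add_mem (add_mem (formPart_le _ (superComm_mem_formPart ha hc))
    (formPart_le _ (superComm_mem_formPart hb hc)))
    (add_mem (formPart_le _ (superComm_mem_formPart ha hd))
    (formPart_le _ (superComm_mem_formPart hb hd)))

theorem isCompl_formPart :
    IsCompl ((formPart p B 0).comap (preservingForm p B).subtype)
      ((formPart p B 1).comap (preservingForm p B).subtype) := by
  constructor
  · rw [Submodule.disjoint_def]
    rintro ⟨X, hX⟩ h0 h1
    ext a b
    by_cases h : p a = p b + 0
    · refine h1.1 a b ?_
      rw [h]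
      simp
    · exact h0.1 a b h
  · rw [codisjoint_iff, eq_top_iff]
    rintro ⟨X, hX⟩ -
    obtain ⟨a, ha, b, hb, rfl⟩ := Submodule.mem_sup.1 hX
    exact Submodule.mem_sup.2 ⟨⟨a, formPart_le _ ha⟩, ha, ⟨b, formPart_le _ hb⟩, hb, rfl⟩

/-- The matrices preserving a form are a Lie superalgebra under the supercommutator. -/
instance preservingForm.instLieSuperalgebra : LieSuperalgebra (preservingForm p B) where
  part i := (formPart p B i).comap (preservingForm p B).subtype
  isCompl_part := isCompl_formPart
  sbr := LinearMap.mk₂ ℂ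
    (fun X Y => ⟨superComm p X.1 Y.1, superComm_mem_preservingForm X.2 Y.2⟩)
    (by intros; ext1; simp) (by intros; ext1; simp)
    (by intros; ext1; simp) (by intros; ext1; simp)
  sbr_mem hX hY := superComm_mem_formPart hX hY
  sbr_skew := by
    intro i j X Y hX hY
    replace hX : X.1 ∈ formPart p B i := hX
    replace hY : Y.1 ∈ formPart p B j := hY
    ext1
    change superComm p X.1 Y.1 = -(koszulSign i j • superComm p Y.1 X.1)
    rw [superComm_apply hX.1 hY.1, superComm_apply hY.1 hX.1]
    rcases zmod2_cases i with rfl | rfl <;> rcases zmod2_cases j with rfl | rfl <;>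
       simp [koszulSign]
  sbr_jacobi := by
    intro i j X Y hX hY Z
    replace hX : X.1 ∈ formPart p B i := hX
    replace hY : Y.1 ∈ formPart p B j := hY
    ext1
    change superComm p X.1 (superComm p Y.1 Z.1) = superComm p (superComm p X.1 Y.1) Z.1 +
      koszulSign i j • superComm p Y.1 (superComm p X.1 Z.1)
    have key : ∀ k, ∀ W ∈ formPart p B k,
        superComm p X.1 (superComm p Y.1 W) = superComm p (superComm p X.1 Y.1) W +
          koszulSign i j • superComm p Y.1 (superComm p X.1 W) := by
      intro k W hW
      rw [superComm_apply hX.1 (superComm_mem_glPart hY.1 hW.1),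
        superComm_apply (superComm_mem_glPart hX.1 hY.1) hW.1,
        superComm_apply hY.1 (superComm_mem_glPart hX.1 hW.1),
        superComm_apply hX.1 hY.1, superComm_apply hY.1 hW.1, superComm_apply hX.1 hW.1]
      rcases zmod2_cases i with rfl | rfl <;> rcases zmod2_cases j with rfl | rfl <;>
        rcases zmod2_cases k with rfl | rfl <;>
        simp [koszulSign, zmod2_one_add_one] <;> noncomm_ring
    obtain ⟨a, ha, b, hb, h⟩ := Submodule.mem_sup.1 Z.2
    rw [← h]
    simp only [map_add, key 0 a ha, key 1 b hb, smul_add]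
    abel

end PreservingForm

/-! ### The ortho-symplectic Lie superalgebras -/

/-- Index set of a basis of `ℂ^(2m+k | 2n)`: even vectors `zero a` (`a : Fin k`), `eps j`,
`epsBar j` (`j : Fin m`) and odd vectors `del i`, `delBar i` (`i : Fin n`). -/
inductive OspIndex (k m n : ℕ) : Type
  | zero (a : Fin k)
  | eps (j : Fin m)
  | epsBar (j : Fin m)
  | del (i : Fin n)
  | delBar (i : Fin n)
  deriving DecidableEq, Fintype

namespace OspIndex

variable {k m n : ℕ}

/-- The parity of a basis vector. -/
def parity : OspIndex k m n → ZMod 2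
  | zero _ | eps _ | epsBar _ => 0
  | del _ | delBar _ => 1

/-- The supersymmetric form on `ℂ^(2m+k | 2n)`. -/
def gram : Matrix (OspIndex k m n) (OspIndex k m n) ℂ := Matrix.of fun
  | zero a, zero b => if a = b then 1 else 0
  | eps i, epsBar j => if i = j then 1 else 0
  | epsBar i, eps j => if i = j then 1 else 0
  | del i, delBar j => if i = j then 1 else 0
  | delBar i, del j => if i = j then -1 else 0
  | _, _ => 0

/-- The eigenvalue on a basis vector of the diagonal matrix with entries `d i` on `del i`,
`-d i` on `delBar i`, `e j` on `eps j`, `-e j` on `epsBar j`. -/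
def diagEntry (h : (Fin n → ℂ) × (Fin m → ℂ)) : OspIndex k m n → ℂ
  | zero _ => 0
  | eps j => h.2 j
  | epsBar j => -h.2 j
  | del i => h.1 i
  | delBar i => -h.1 i

end OspIndex

/-- The Lie superalgebra `osp(2m+k | 2n)`, for `k = 0, 1`. -/
abbrev Osp (k m n : ℕ) : Submodule ℂ (Matrix (OspIndex k m n) (OspIndex k m n) ℂ) :=
  preservingForm OspIndex.parity OspIndex.gram

namespace Osp

/-- Coordinates on the Cartan subalgebra: the pair `(d, e)` stands for the diagonal matrix
`OspIndex.diagEntry (d, e)`. -/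
abbrev CartanCoord (m n : ℕ) : Type := (Fin n → ℂ) × (Fin m → ℂ)

/-- The element of the diagonal Cartan subalgebra with coordinates `h`. -/
def cartan (k : ℕ) {m n : ℕ} (h : CartanCoord m n) : Osp k m n :=
  ⟨Matrix.diagonal (OspIndex.diagEntry h), formPart_le 0 (by
    refine ⟨fun a b hab => Matrix.diagonal_apply_ne _ ?_, fun a b => ?_⟩
    · rintro rfl
      simp at hab
    · rw [Matrix.diagonal_transpose, Matrix.diagonal_mul, Matrix.mul_diagonal]
      cases a <;> cases b <;>
        simp [OspIndex.gram, OspIndex.diagEntry, koszulSign] <;>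
        (split_ifs with hij <;> simp_all))⟩

/-- Weights: linear functionals on the Cartan subalgebra. -/
abbrev Weight (m n : ℕ) : Type := Module.Dual ℂ (CartanCoord m n)

variable {m n : ℕ}

/-- The weight `δ_i` of the natural module. -/
def wδ (i : Fin n) : Weight m n := LinearMap.proj i ∘ₗ LinearMap.fst ℂ _ _

/-- The weight `ε_j` of the natural module. -/
def wε (j : Fin m) : Weight m n := LinearMap.proj j ∘ₗ LinearMap.snd ℂ _ _

/-- A weight is integral if it lies in the `ℤ`-span of the `δ_i` and the `ε_j`. -/
def IsIntegral (lam : Weight m n) : Prop :=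
  lam ∈ Submodule.span ℤ (Set.range (wδ (m := m) (n := n)) ∪ Set.range (wε (m := m) (n := n)))

/-- The positive roots of `osp(2m+k | 2n)` for the standard Borel subalgebra, whose simple roots
are `δ₁ - δ₂, …, δₙ₋₁ - δₙ, δₙ - ε₁, ε₁ - ε₂, …, εₘ₋₁ - εₘ` followed by `εₘ` if `k = 1` and
by `εₘ₋₁ + εₘ` if `k = 0`. -/
inductive IsPositiveRoot (k : ℕ) : Weight m n → Prop
  | del_sub_del (i j : Fin n) (h : i < j) : IsPositiveRoot k (wδ i - wδ j)
  | del_add_del (i j : Fin n) (h : i ≤ j) : IsPositiveRoot k (wδ i + wδ j)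
  | del_sub_eps (i : Fin n) (j : Fin m) : IsPositiveRoot k (wδ i - wε j)
  | del_add_eps (i : Fin n) (j : Fin m) : IsPositiveRoot k (wδ i + wε j)
  | eps_sub_eps (i j : Fin m) (h : i < j) : IsPositiveRoot k (wε i - wε j)
  | eps_add_eps (i j : Fin m) (h : i < j) : IsPositiveRoot k (wε i + wε j)
  | del (i : Fin n) (hk : k = 1) : IsPositiveRoot k (wδ i)
  | eps (j : Fin m) (hk : k = 1) : IsPositiveRoot k (wε j)

/-- `x` lies in the root space of `α`. -/
def IsRootVector {k : ℕ} (α : Weight m n) (x : Osp k m n) : Prop :=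
  ∀ h : CartanCoord m n, LieSuperalgebra.sbr (cartan k h) x = α h • x

variable {V : Type*} [AddCommGroup V] [Module ℂ V]

/-- `v` is a highest weight vector of weight `lam` for the standard Borel subalgebra. -/
def IsHighestWeightVector {k : ℕ} (ρ : SuperRep (Osp k m n) V) (lam : Weight m n) (v : V) :
    Prop :=
  v ≠ 0 ∧ (∀ h : CartanCoord m n, ρ.act (cartan k h) v = lam h • v) ∧
    ∀ (α : Weight m n) (x : Osp k m n), IsPositiveRoot k α → IsRootVector α x → ρ.act x v = 0

/-- The highest weight of the module `V` for the standard Borel subalgebra is integral. -/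
def HasIntegralHighestWeight {k : ℕ} (ρ : SuperRep (Osp k m n) V) : Prop :=
  ∃ (lam : Weight m n) (v : V), IsIntegral lam ∧ IsHighestWeightVector ρ lam v

end Osp

end

/-! A finite dimensional irreducible module is determined by its highest weight and the parity of
its highest weight vector, so it suffices to find in `V*` a highest weight vector with the same
weight `lam` and the same parity `q` as in `V`.

Such a vector is a functional that lives on the weight space of weight `-lam`. It is a highest
weight vector because `-lam` is the lowest weight of `V`, and this holds as soon as the set of
weights is stable under `-1`. That stability comes from the Weyl group of the even part, acting
through `sl₂`-triples (`weightSpace_reflect`). The roots `2δ_i` change the sign of single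
`δ`-coordinates. For `M` odd the roots `ε_j` do the same for the `ε`-coordinates. For `M = 2m` the
roots `ε_i - ε_j` and `ε_i + ε_j` together only change two signs at once, so all `m` signs can be
changed when `m` is even (`weightSpace_neg`).

The parity of a weight vector is governed by its weight: a vector of weight `x` has parity `q +
parity (x - lam)` (`Descendant.mem_part`). At `x = -lam` the shift is the parity of `-2 lam`, which
is `0` since `lam` is integral. This makes the final isomorphism even, not merely an isomorphism up
to parity shift.

Uniqueness of the highest weight module is the usual graph argument. If `w` and `f` are the highest
weight vectors of `V` and `V*`, the submodule `N` of `V ⊕ V*` generated by `(w, f)` projects onto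
`V`. It meets `V` trivially, because its vectors of weight `lam` are multiples of `(w, f)`.
Comparing dimensions, `N` is the graph of an isomorphism (`isIsomorphic_of_submodule_prod`);
irreducibility of `V*` is not needed.

Weights are compared through an integer height, positive on positive roots and represented by one
Cartan element, so that independence of the eigenspaces of a single operator replaces a full weight
decomposition. -/

noncomputable section

/-! ### Root vectors of the ortho-symplectic Lie superalgebras -/

/-- The lattice spanned by the `δ_i` and the `ε_j`, in coordinates. -/
abbrev IntWeight (m n : ℕ) : Type := (Fin n → ℤ) × (Fin m → ℤ)

/-! ### Integral weights in coordinates, their parity and height -/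

namespace IntWeight

variable {m n : ℕ}

/-- The value of an integral weight on the Cartan subalgebra. -/
def eval : IntWeight m n →+ Osp.CartanCoord m n → ℂ :=
  AddMonoidHom.mk' (fun x h => ∑ i, (x.1 i : ℂ) * h.1 i + ∑ j, (x.2 j : ℂ) * h.2 j) (by
    intro x y
    funext h
    simp only [Prod.fst_add, Prod.snd_add, Pi.add_apply, Int.cast_add, add_mul,
      Finset.sum_add_distrib]
    ring)

theorem eval_apply (x : IntWeight m n) (h : Osp.CartanCoord m n) :
    eval x h = ∑ i, (x.1 i : ℂ) * h.1 i + ∑ j, (x.2 j : ℂ) * h.2 j := rfl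

theorem eval_neg_right (x : IntWeight m n) (h : Osp.CartanCoord m n) :
    eval x (-h) = -eval x h := by
  simp [eval_apply, add_comm]

theorem eval_injective : Function.Injective (eval (m := m) (n := n)) := by
  intro x y hxy
  ext i
  · have := congrFun hxy (Pi.single i 1, 0)
    simpa [eval_apply, Pi.single_apply] using this
  · have := congrFun hxy (0, Pi.single i 1)
    simpa [eval_apply, Pi.single_apply] using this

/-- The parity of an integral weight: `δ_i` is odd and `ε_j` is even. -/
def parity : IntWeight m n →+ ZMod 2 :=
  AddMonoidHom.mk' (fun x => ∑ i, (x.1 i : ZMod 2)) (by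
    intro x y
    simp [Finset.sum_add_distrib])

/-- A height function on integral weights that is positive on all positive roots. -/
def height : IntWeight m n →+ ℤ :=
  AddMonoidHom.mk' (fun x => ∑ i, x.1 i * ((m : ℤ) + n - i) + ∑ j, x.2 j * ((m : ℤ) - j)) (by
    intro x y
    simp only [Prod.fst_add, Prod.snd_add, Pi.add_apply, add_mul, Finset.sum_add_distrib]
    ring)

/-- The element of the Cartan subalgebra that represents the height function. -/
def heightCoord : Osp.CartanCoord m n :=
  (fun i => (m : ℂ) + n - (i : ℕ), fun j => (m : ℂ) - (j : ℕ))

theorem eval_heightCoord (x : IntWeight m n) : eval x heightCoord = (height x : ℂ) := by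
  simp [eval_apply, heightCoord, height]

end IntWeight

/-! ### Duality, weights and signs of the basis vectors -/

namespace OspIndex

variable {k m n : ℕ}

/-- The index of the basis vector that pairs non-trivially with the given one. -/
def bar : OspIndex k m n → OspIndex k m n
  | zero a => zero a
  | eps j => epsBar j
  | epsBar j => eps j
  | del i => delBar i
  | delBar i => del i

@[simp] theorem bar_bar (a : OspIndex k m n) : a.bar.bar = a := by cases a <;> rfl

theorem bar_inj {a b : OspIndex k m n} : a.bar = b.bar ↔ a = b :=
  ⟨fun h => by rw [← bar_bar a, h, bar_bar], fun h => by rw [h]⟩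

theorem eq_bar_iff {a b : OspIndex k m n} : a = b.bar ↔ a.bar = b := by
  rw [← bar_inj, bar_bar]

@[simp] theorem parity_bar (a : OspIndex k m n) : a.bar.parity = a.parity := by cases a <;> rfl

/-- The non-zero entry of the row of the Gram matrix. -/
def gramSign : OspIndex k m n → ℂ
  | delBar _ => -1
  | _ => 1

theorem gram_apply (a b : OspIndex k m n) :
    gram a b = if b = a.bar then gramSign a else 0 := by
  cases a <;> cases b <;> simp [gram, bar, gramSign, eq_comm]

theorem diagEntry_bar (h : Osp.CartanCoord m n) (a : OspIndex k m n) :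
    diagEntry h a.bar = -diagEntry h a := by
  cases a <;> simp [bar, diagEntry]

/-- The weight of a basis vector. -/
def weight : OspIndex k m n → IntWeight m n
  | zero _ => 0
  | eps j => (0, Pi.single j 1)
  | epsBar j => -(0, Pi.single j 1)
  | del i => (Pi.single i 1, 0)
  | delBar i => -(Pi.single i 1, 0)

theorem eval_weight (a : OspIndex k m n) (h : Osp.CartanCoord m n) :
    IntWeight.eval a.weight h = diagEntry h a := by
  cases a <;> simp [weight, diagEntry, IntWeight.eval_apply, Pi.single_apply]

theorem parity_weight (a : OspIndex k m n) : IntWeight.parity a.weight = a.parity := by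
  cases a <;> simp [weight, IntWeight.parity, OspIndex.parity, Pi.single_apply]

/-- The coefficient of the second term of a root vector. -/
def rootSign (a b : OspIndex k m n) : ℂ :=
  koszulSign (a.parity + b.parity) b.parity * (gramSign a * gramSign b)

theorem transpose_mul_gram_apply (X : Matrix (OspIndex k m n) (OspIndex k m n) ℂ)
    (a b : OspIndex k m n) :
    (X.transpose * gram : Matrix _ _ ℂ) a b = X b.bar a * gramSign b.bar := by
  have h : ∀ c : OspIndex k m n, (b = c.bar) = (c = b.bar) := fun c => by
    rw [eq_bar_iff, @eq_comm _ c]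
  simp [Matrix.mul_apply, gram_apply, h]

theorem gram_mul_apply (X : Matrix (OspIndex k m n) (OspIndex k m n) ℂ)
    (a b : OspIndex k m n) :
    (gram * X : Matrix _ _ ℂ) a b = gramSign a * X a.bar b := by
  simp [Matrix.mul_apply, gram_apply]

/-- This identity and the next are what invariance of the form says about a root matrix at the two
positions where its condition is not trivial, `(b, a.bar)` and `(a.bar, b)`. -/
theorem gramSign_eq_of_rootSign (a b : OspIndex k m n) :
    gramSign a = koszulSign (a.parity + b.parity) b.parity * gramSign b * rootSign a b := by
  cases a <;> cases b <;> simp [rootSign, gramSign, OspIndex.parity, koszulSign, zmod2_one_add_one]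

theorem rootSign_mul_gramSign_bar (a b : OspIndex k m n) :
    rootSign a b * gramSign b.bar =
      koszulSign (a.parity + b.parity) a.parity * gramSign a.bar := by
  cases a <;> cases b <;>
    simp [rootSign, gramSign, OspIndex.parity, koszulSign, zmod2_one_add_one, bar]

end OspIndex

/-! ### Root vectors: invariance, weights and spanning -/

namespace Osp

open OspIndex

variable {k m n : ℕ}

/-- The matrix underlying the root vector of weight `weight a - weight b`. -/
def rootMatrix (a b : OspIndex k m n) : Matrix (OspIndex k m n) (OspIndex k m n) ℂ :=
  Matrix.single a b 1 - rootSign a b • Matrix.single b.bar a.bar 1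

theorem rootMatrix_apply (a b c d : OspIndex k m n) :
    rootMatrix a b c d = (if a = c ∧ b = d then 1 else 0) -
      rootSign a b * (if a = d.bar ∧ b = c.bar then 1 else 0) := by
  have h : (b.bar = c ∧ a.bar = d) = (a = d.bar ∧ b = c.bar) := by
    rw [eq_bar_iff, eq_bar_iff, and_comm]
  simp [rootMatrix, Matrix.single_apply, h]

theorem rootMatrix_mem (a b : OspIndex k m n) :
    rootMatrix a b ∈ formPart OspIndex.parity gram (a.parity + b.parity) := by
  refine ⟨fun c d h => ?_, fun c d => ?_⟩
  · rw [rootMatrix_apply, if_neg, if_neg]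
    · simp
    · rintro ⟨rfl, rfl⟩
      apply h
      rw [parity_bar, parity_bar]
      generalize c.parity = x
      generalize d.parity = y
      revert x y; decide
    · rintro ⟨rfl, rfl⟩
      apply h
      generalize a.parity = x
      generalize b.parity = y
      revert x y; decide
  · rw [transpose_mul_gram_apply, gram_mul_apply, rootMatrix_apply, rootMatrix_apply]
    simp only [bar_bar]
    -- The two non-trivial positions of the invariance condition; they coincide when `b = a.bar`,
    -- and then both sign identities are used at once.
    by_cases h1 : a = d.bar ∧ b = c <;> by_cases h2 : a = c.bar ∧ b = d
    · obtain ⟨h3, rfl⟩ := h1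
      have h4 := gramSign_eq_of_rootSign a b
      have h5 := rootSign_mul_gramSign_bar a b
      obtain ⟨h6, rfl⟩ := h2
      subst h6
      simp only [bar_bar, parity_bar, and_self, if_true] at *
      linear_combination h4 - h5
    · obtain ⟨rfl, rfl⟩ := h1
      have h4 := gramSign_eq_of_rootSign d.bar b
      simp only [if_neg h2, and_self, if_true]
      linear_combination h4
    · obtain ⟨rfl, rfl⟩ := h2
      have h4 := rootSign_mul_gramSign_bar c.bar b
      simp only [bar_bar, parity_bar] at h4
      simp only [if_neg h1, and_self, if_true, parity_bar]
      linear_combination -h4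
    · simp [h1, h2]

/-- The root vector of weight `weight a - weight b`. -/
def rootVec (a b : OspIndex k m n) : Osp k m n :=
  ⟨rootMatrix a b, formPart_le _ (rootMatrix_mem a b)⟩

theorem rootVec_mem (a b : OspIndex k m n) :
    rootVec a b ∈ (LieSuperalgebra.toSuperSpace (𝔤 := Osp k m n)).part (a.parity + b.parity) :=
  rootMatrix_mem a b

theorem cartan_mem (h : CartanCoord m n) :
    cartan k h ∈ (LieSuperalgebra.toSuperSpace (𝔤 := Osp k m n)).part 0 := by
  change Matrix.diagonal (diagEntry h) ∈ formPart _ _ 0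
  refine ⟨fun a b hab => Matrix.diagonal_apply_ne _ ?_, fun a b => ?_⟩
  · rintro rfl
    simp at hab
  · rw [transpose_mul_gram_apply, gram_mul_apply, Matrix.diagonal_apply, Matrix.diagonal_apply]
    by_cases hab : a = b.bar
    · subst hab
      simp [diagEntry_bar, koszulSign]
      ring
    · rw [if_neg (Ne.symm hab), if_neg (fun h => hab (eq_bar_iff.2 h))]
      simp

theorem sbr_val_of_mem {i j : ZMod 2} {X Y : Osp k m n}
    (hX : X ∈ (LieSuperalgebra.toSuperSpace (𝔤 := Osp k m n)).part i)
    (hY : Y ∈ (LieSuperalgebra.toSuperSpace (𝔤 := Osp k m n)).part j) :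
    (LieSuperalgebra.sbr X Y).1 = X.1 * Y.1 - koszulSign i j • (Y.1 * X.1) :=
  superComm_apply (p := OspIndex.parity) (And.left hX) (And.left hY)

theorem isRootVector_rootVec (a b : OspIndex k m n) (h : CartanCoord m n) :
    LieSuperalgebra.sbr (cartan k h) (rootVec a b) =
      (diagEntry h a - diagEntry h b) • rootVec a b := by
  ext1
  rw [sbr_val_of_mem (cartan_mem h) (rootVec_mem a b)]
  ext c d
  change (Matrix.diagonal (diagEntry h) * rootMatrix a b - koszulSign 0 _ •
    (rootMatrix a b * Matrix.diagonal (diagEntry h)) : Matrix _ _ ℂ) c d =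
    (diagEntry h a - diagEntry h b) * rootMatrix a b c d
  rw [Matrix.sub_apply, Matrix.smul_apply, Matrix.diagonal_mul, Matrix.mul_diagonal,
    rootMatrix_apply]
  simp only [koszulSign, zero_ne_one, false_and, if_false, one_smul]
  by_cases h1 : a = c ∧ b = d <;> by_cases h2 : a = d.bar ∧ b = c.bar
  · obtain ⟨rfl, rfl⟩ := h1
    ring
  · obtain ⟨rfl, rfl⟩ := h1
    ring
  · rw [if_neg h1]
    obtain ⟨rfl, rfl⟩ := h2
    rw [diagEntry_bar, diagEntry_bar]
    ring
  · simp [h1, h2]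

/-- The root vectors span the Lie superalgebra. -/
theorem span_rootVec :
    Submodule.span ℂ {x : Osp k m n | ∃ a b, x = rootVec a b} = ⊤ := by
  have key : ∀ i, ∀ X : Osp k m n, X.1 ∈ formPart OspIndex.parity gram i →
      X ∈ Submodule.span ℂ {x : Osp k m n | ∃ a b, x = rootVec a b} := by
    intro i X hX
    -- The sum is `X` plus its image under the involution fixing the matrices that preserve the
    -- form, so it equals `2 X`; hence the factor `2⁻¹`.
    have hs : X = (2⁻¹ : ℂ) • ∑ a, ∑ b, X.1 a b • rootVec a b := by
      ext1
      ext c d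
      have e : (((2⁻¹ : ℂ) • ∑ a, ∑ b, X.1 a b • rootVec a b : Osp k m n) :
          Matrix _ _ ℂ) c d = 2⁻¹ * ∑ a, ∑ b, X.1 a b * rootMatrix a b c d := by
        simp only [Submodule.coe_smul, Submodule.coe_sum, Matrix.smul_apply, Matrix.sum_apply,
          smul_eq_mul]
        rfl
      rw [e]
      have e2 : ∑ a, ∑ b, X.1 a b * rootMatrix a b c d =
          X.1 c d - rootSign d.bar c.bar * X.1 d.bar c.bar := by
        simp only [rootMatrix_apply, mul_sub, Finset.sum_sub_distrib]
        congr 1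
        · rw [Finset.sum_eq_single c, Finset.sum_eq_single d] <;> simp +contextual
        · rw [Finset.sum_eq_single d.bar, Finset.sum_eq_single c.bar] <;>
            simp +contextual [mul_comm]
      rw [e2]
      by_cases hp : c.parity = d.parity + i
      · have h1 := hX.2 c.bar d
        rw [transpose_mul_gram_apply, gram_mul_apply, bar_bar, parity_bar] at h1
        have h2 := rootSign_mul_gramSign_bar d.bar c.bar
        have h3 : gramSign d.bar * gramSign d.bar = 1 := by cases d <;> simp [gramSign, bar]
        have h4 : koszulSign i c.parity = koszulSign i d.parity * koszulSign i i := by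
          rw [hp]
          generalize d.parity = x
          rcases zmod2_cases i with rfl | rfl <;> rcases zmod2_cases x with rfl | rfl <;>
            simp [koszulSign, zmod2_one_add_one]
        have h6 : gramSign c.bar * gramSign c.bar = 1 := by cases c <;> simp [gramSign, bar]
        have h7 : koszulSign i c.parity * koszulSign i c.parity = 1 := by
          unfold koszulSign; split_ifs <;> simp
        have h5 : rootSign d.bar c.bar =
            koszulSign i c.parity * gramSign c.bar * gramSign d.bar := by
          have : d.parity + c.parity = i := by
            rw [hp, ← add_assoc]
            have : d.parity + d.parity = 0 := by
              generalize d.parity = x; revert x; decide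
            rw [this, zero_add]
          rw [rootSign, parity_bar, parity_bar, this]
          ring
        have h8 : X.1 c d = - (rootSign d.bar c.bar * X.1 d.bar c.bar) := by
          rw [h5]
          linear_combination (koszulSign i c.parity * gramSign c.bar) * h1 -
            X.1 c d * gramSign c.bar * gramSign c.bar * h7 - X.1 c d * h6
        linear_combination (2⁻¹ : ℂ) * h8
      · have h1 : X.1 c d = 0 := hX.1 c d hp
        have h2 : X.1 d.bar c.bar = 0 := by
          refine hX.1 _ _ ?_
          rw [parity_bar, parity_bar]
          contrapose! hp
          rw [hp, add_assoc]
          have : i + i = 0 := by rcases zmod2_cases i with rfl | rfl <;> decide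
          rw [this, add_zero]
        rw [h1, h2]
        simp
    rw [hs]
    exact Submodule.smul_mem _ _ (Submodule.sum_mem _ fun a _ => Submodule.sum_mem _ fun b _ =>
      Submodule.smul_mem _ _ (Submodule.subset_span ⟨a, b, rfl⟩))
  rw [eq_top_iff]
  rintro X -
  obtain ⟨Y, hY, Z, hZ, h⟩ := Submodule.mem_sup.1 X.2
  have : X = ⟨Y, formPart_le 0 hY⟩ + ⟨Z, formPart_le 1 hZ⟩ := Subtype.ext h.symm
  rw [this]
  exact add_mem (key 0 _ hY) (key 1 _ hZ)

theorem cartan_neg (h : CartanCoord m n) : cartan k (-h) = -cartan k h := by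
  ext a b
  change Matrix.diagonal (diagEntry (-h)) a b = - Matrix.diagonal (diagEntry h) a b
  rw [Matrix.diagonal_apply, Matrix.diagonal_apply]
  split_ifs
  · cases a <;> simp [diagEntry]
  · simp

theorem diagEntry_weight (a c : OspIndex k m n) :
    diagEntry (fun i => (a.weight.1 i : ℂ), fun j => (a.weight.2 j : ℂ)) c =
      (if a = c then 1 else 0) - (if a = c.bar then 1 else 0) := by
  cases a <;> cases c <;>
    simp [weight, diagEntry, bar, Pi.single_apply, eq_comm]

/-- The root matrix is `E_aa` minus `E` at the position of `a.bar`, because the sign is `1` when the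
two indices agree. It vanishes for an index of type `zero`. -/
theorem rootVec_self (a : OspIndex k m n) :
    rootVec a a = cartan k (fun i => (a.weight.1 i : ℂ), fun j => (a.weight.2 j : ℂ)) := by
  ext c d
  change rootMatrix a a c d = Matrix.diagonal (diagEntry _) c d
  have h : rootSign a a = 1 := by
    cases a <;> simp [rootSign, gramSign, OspIndex.parity, koszulSign, zmod2_one_add_one]
  rw [rootMatrix_apply, h, Matrix.diagonal_apply]
  by_cases hcd : c = d
  · subst hcd
    simp [diagEntry_weight]
  · rw [if_neg hcd, if_neg, if_neg]
    · simp
    · rintro ⟨rfl, h⟩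
      exact hcd (bar_inj.1 h).symm
    · rintro ⟨rfl, h⟩
      exact hcd h

theorem height_weight (a : OspIndex k m n) : IntWeight.height a.weight =
    match a with
    | zero _ => 0
    | eps j => (m : ℤ) - j
    | epsBar j => -((m : ℤ) - j)
    | del i => (m : ℤ) + n - i
    | delBar i => -((m : ℤ) + n - i) := by
  cases a <;> simp [weight, IntWeight.height, Pi.single_apply]

/-- A root vector between basis vectors of equal height lies in the Cartan subalgebra. -/
theorem exists_rootVec_eq_cartan (hk : k ≤ 1) {a b : OspIndex k m n}
    (hab : IntWeight.height a.weight = IntWeight.height b.weight) :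
    ∃ h, rootVec a b = cartan k h := by
  -- For `k ≤ 1` the heights of the basis vectors are distinct: `m + n, …, m + 1` for the `δ_i`, `m,
  -- …, 1` for the `ε_j`, their negatives, and at most one zero.
  suffices a = b by
    subst this
    exact ⟨_, rootVec_self a⟩
  rw [height_weight, height_weight] at hab
  cases a <;> cases b <;> simp only [reduceCtorEq, zero.injEq, eps.injEq, epsBar.injEq,
    del.injEq, delBar.injEq, Fin.ext_iff] at hab ⊢ <;> omega

/-- The two matrix units in the root matrix coincide and cancel: `2ε_j` is not a root. For `2δ_i`
the symplectic sign makes them add up instead. -/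
theorem rootVec_eps_epsBar (j : Fin m) : rootVec (k := k) (n := n) (eps j) (epsBar j) = 0 := by
  ext c d
  change rootMatrix (eps j) (epsBar j) c d = 0
  rw [rootMatrix_apply]
  have h : ((eps j = c ∧ epsBar j = d) = (eps j = d.bar ∧ epsBar j = c.bar)) := by
    rw [eq_bar_iff, eq_bar_iff, and_comm]
    rfl
  simp [h, rootSign, gramSign, OspIndex.parity, koszulSign]

/-- A root vector between basis vectors of decreasing height belongs to a positive root. -/
theorem rootVec_eq_zero_or_isPositiveRoot (hk : k ≤ 1) {a b : OspIndex k m n}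
    (hab : IntWeight.height b.weight < IntWeight.height a.weight) :
    rootVec a b = 0 ∨ ∃ α : Weight m n, IsPositiveRoot k α ∧ IsRootVector α (rootVec a b) := by
  have aux : ∀ α : Weight m n, IsPositiveRoot k α →
      (∀ h, diagEntry h a - diagEntry h b = α h) →
      rootVec a b = 0 ∨ ∃ α : Weight m n, IsPositiveRoot k α ∧ IsRootVector α (rootVec a b) :=
    fun α hα h => Or.inr ⟨α, hα, fun h' => by rw [isRootVector_rootVec, h]⟩
  rw [height_weight, height_weight] at hab
  rcases a with a | i | i | i | i <;> rcases b with b | j | j | j | j <;> simp only at hab <;>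
    try omega
  · exact aux _ (.eps j (by have := Fin.isLt ‹Fin k›; omega)) fun h => by simp [diagEntry, wε]
  · exact aux _ (.del j (by have := Fin.isLt ‹Fin k›; omega)) fun h => by simp [diagEntry, wδ]
  · exact aux _ (.eps i (by have := Fin.isLt ‹Fin k›; omega)) fun h => by simp [diagEntry, wε]
  · exact aux _ (.eps_sub_eps i j (Fin.lt_def.2 (by omega))) fun h => by simp [diagEntry, wε]
  · rcases lt_trichotomy i j with hij | rfl | hij
    · exact aux _ (.eps_add_eps i j hij) fun h => by simp [diagEntry, wε]
    · exact Or.inl (rootVec_eps_epsBar i)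
    · exact aux _ (.eps_add_eps j i hij) fun h => by simp [diagEntry, wε, add_comm]
  · exact aux _ (.del_add_eps j i) fun h => by simp [diagEntry, wε, wδ, add_comm]
  · exact aux _ (.eps_sub_eps j i (Fin.lt_def.2 (by omega))) fun h => by
      simp [diagEntry, wε]; ring
  · exact aux _ (.del_sub_eps j i) fun h => by simp [diagEntry, wε, wδ]; ring
  · exact aux _ (.del i (by have := Fin.isLt ‹Fin k›; omega)) fun h => by simp [diagEntry, wδ]
  · exact aux _ (.del_sub_eps i j) fun h => by simp [diagEntry, wε, wδ]
  · exact aux _ (.del_add_eps i j) fun h => by simp [diagEntry, wε, wδ]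
  · exact aux _ (.del_sub_del i j (Fin.lt_def.2 (by omega))) fun h => by simp [diagEntry, wδ]
  · rcases le_total i j with hij | hij
    · exact aux _ (.del_add_del i j hij) fun h => by simp [diagEntry, wδ]
    · exact aux _ (.del_add_del j i hij) fun h => by simp [diagEntry, wδ, add_comm]
  · exact aux _ (.del_sub_del j i (Fin.lt_def.2 (by omega))) fun h => by
      simp [diagEntry, wδ]; ring

/-! ### Brackets of opposite even root vectors -/

theorem sbr_rootVec_val {a b : OspIndex k m n} (h : a.parity = b.parity) :
    (LieSuperalgebra.sbr (rootVec a b) (rootVec b a)).1 =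
      rootMatrix a b * rootMatrix b a - rootMatrix b a * rootMatrix a b := by
  have h2 : a.parity + b.parity = 0 := by rw [h]; generalize b.parity = x; revert x; decide
  rw [sbr_val_of_mem (rootVec_mem a b) (rootVec_mem b a), h2]
  simp [koszulSign]
  rfl

theorem sbr_rootVec_neg {a b : OspIndex k m n} (h : a.parity = b.parity) :
    LieSuperalgebra.sbr (rootVec b a) (rootVec a b) =
      -LieSuperalgebra.sbr (rootVec a b) (rootVec b a) := by
  ext1
  rw [Submodule.coe_neg, sbr_rootVec_val h, sbr_rootVec_val h.symm, neg_sub]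

/-- This and the three lemmas after it supply the `sl₂`-triples of the reflections, with the Cartan
element on the right normalised to be the coroot. Here the factor is `4` because each root vector is
twice a matrix unit. -/
theorem sbr_rootVec_del (i : Fin n) :
    LieSuperalgebra.sbr (rootVec (k := k) (m := m) (del i) (delBar i))
      (rootVec (delBar i) (del i)) = (4 : ℂ) • cartan k (Pi.single i 1, 0) := by
  ext1
  rw [sbr_rootVec_val (a := del i) (b := delBar i) rfl]
  ext c d
  change _ = 4 * Matrix.diagonal (diagEntry (Pi.single i 1, 0)) c d
  simp [rootMatrix, add_mul, mul_add, bar, rootSign, gramSign, OspIndex.parity, koszulSign,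
    Matrix.single_apply, Matrix.diagonal_apply]
  cases c <;> cases d <;> simp [diagEntry, Pi.single_apply]
  all_goals grind

/-- The coroot of `ε_i` has coordinate `2`, while the commutator has coordinate `1`; hence the
factor `2⁻¹`. This triple exists only when the natural module has a zero weight vector. -/
theorem sbr_rootVec_eps_zero (i : Fin m) (z : Fin k) :
    LieSuperalgebra.sbr (rootVec (k := k) (n := n) (eps i) (zero z))
      (rootVec (zero z) (eps i)) = (2⁻¹ : ℂ) • cartan k (0, Pi.single i 2) := by
  ext1
  rw [sbr_rootVec_val (a := eps i) (b := zero z) rfl]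
  ext c d
  change _ = 2⁻¹ * Matrix.diagonal (diagEntry (0, Pi.single i 2)) c d
  simp [rootMatrix, sub_mul, mul_sub, bar, rootSign, gramSign, OspIndex.parity, koszulSign,
    Matrix.single_apply, Matrix.diagonal_apply]
  cases c <;> cases d <;> simp [diagEntry, Pi.single_apply]
  all_goals grind

theorem sbr_rootVec_eps_eps {i j : Fin m} (hij : i ≠ j) :
    LieSuperalgebra.sbr (rootVec (k := k) (n := n) (eps i) (eps j))
      (rootVec (eps j) (eps i)) = (1 : ℂ) • cartan k (0, Pi.single i 1 - Pi.single j 1) := by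
  ext1
  rw [sbr_rootVec_val (a := eps i) (b := eps j) rfl]
  ext c d
  change _ = 1 * Matrix.diagonal (diagEntry (0, Pi.single i 1 - Pi.single j 1)) c d
  simp [rootMatrix, sub_mul, mul_sub, bar, rootSign, gramSign, OspIndex.parity, koszulSign,
    Matrix.single_apply, Matrix.diagonal_apply]
  cases c <;> cases d <;> simp [diagEntry, Pi.single_apply]
  all_goals grind

theorem sbr_rootVec_eps_epsBar {i j : Fin m} (hij : i ≠ j) :
    LieSuperalgebra.sbr (rootVec (k := k) (n := n) (eps i) (epsBar j))
      (rootVec (epsBar j) (eps i)) = (1 : ℂ) • cartan k (0, Pi.single i 1 + Pi.single j 1) := by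
  ext1
  rw [sbr_rootVec_val (a := eps i) (b := epsBar j) rfl]
  ext c d
  change _ = 1 * Matrix.diagonal (diagEntry (0, Pi.single i 1 + Pi.single j 1)) c d
  simp [rootMatrix, sub_mul, mul_sub, bar, rootSign, gramSign, OspIndex.parity, koszulSign,
    Matrix.single_apply, Matrix.diagonal_apply, hij, hij.symm]
  cases c <;> cases d <;> simp [diagEntry, Pi.single_apply]
  all_goals grind

end Osp


/-! ### Weight spaces and highest weight modules -/

namespace Osp

open OspIndex

variable {k m n : ℕ} {V : Type*} [AddCommGroup V] [Module ℂ V] (ρ : SuperRep (Osp k m n) V)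

theorem act_cartan_act_rootVec (h : CartanCoord m n) (a b : OspIndex k m n) (v : V) :
    ρ.act (cartan k h) (ρ.act (rootVec a b) v) =
      (diagEntry h a - diagEntry h b) • ρ.act (rootVec a b) v +
        ρ.act (rootVec a b) (ρ.act (cartan k h) v) := by
  have h1 := ρ.act_sbr (cartan_mem h) (rootVec_mem a b) v
  rw [isRootVector_rootVec, map_smul, LinearMap.smul_apply] at h1
  rw [h1]
  simp [koszulSign]

/-- The weight space of an integral weight. -/
def weightSpace (x : IntWeight m n) : Submodule ℂ V where
  carrier := {v | ∀ h, ρ.act (cartan k h) v = IntWeight.eval x h • v}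
  zero_mem' := by simp
  add_mem' := fun {u v} hu hv h => by rw [map_add, hu h, hv h, smul_add]
  smul_mem' := fun c v hv h => by rw [map_smul, hv h, smul_comm]

theorem act_rootVec_mem_weightSpace {x : IntWeight m n} {v : V} (hv : v ∈ weightSpace ρ x)
    (a b : OspIndex k m n) :
    ρ.act (rootVec a b) v ∈ weightSpace ρ (x + (a.weight - b.weight)) := by
  intro h
  rw [act_cartan_act_rootVec, hv h, map_smul, ← add_smul, map_add, map_sub, Pi.add_apply,
    Pi.sub_apply, eval_weight, eval_weight, add_comm]

/-- The eigenspaces of the element of the Cartan subalgebra that measures the height. -/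
abbrev heightSpace (c : ℂ) : Submodule ℂ V :=
  Module.End.eigenspace (ρ.act (cartan k IntWeight.heightCoord)) c

variable {ρ} in
theorem mem_heightSpace {x : IntWeight m n} {v : V} (hv : v ∈ weightSpace ρ x) :
    v ∈ heightSpace ρ (IntWeight.height x : ℂ) := by
  rw [Module.End.mem_eigenspace_iff, hv, IntWeight.eval_heightCoord]

/-- `w` is a homogeneous highest weight vector of integral weight. -/
structure IsHomogeneousHighestWeightVector (lam : IntWeight m n) (q : ZMod 2) (w : V) : Prop where
  mem_weightSpace : w ∈ weightSpace ρ lam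
  mem_part : w ∈ ρ.part q
  act_eq_zero : ∀ a b : OspIndex k m n, IntWeight.height b.weight < IntWeight.height a.weight →
    ρ.act (rootVec a b) w = 0

/-- The vectors obtained from `w` by applying negative root vectors, with their weights. -/
inductive Descendant (lam : IntWeight m n) (w : V) : IntWeight m n → V → Prop
  | refl : Descendant lam w lam w
  | act {x : IntWeight m n} {u : V} (a b : OspIndex k m n)
      (hab : IntWeight.height a.weight < IntWeight.height b.weight) (hu : Descendant lam w x u) :
      Descendant lam w (x + (a.weight - b.weight)) (ρ.act (rootVec a b) u)

/-- The span of the descendants of `w`. -/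
def descendantSpan (lam : IntWeight m n) (w : V) : Submodule ℂ V :=
  Submodule.span ℂ {u | ∃ x, Descendant ρ lam w x u}

variable {ρ} {lam : IntWeight m n} {q : ZMod 2} {w : V}

theorem mem_descendantSpan : w ∈ descendantSpan ρ lam w :=
  Submodule.subset_span ⟨lam, .refl⟩

theorem Descendant.mem_weightSpace (hw : IsHomogeneousHighestWeightVector ρ lam q w)
    {x : IntWeight m n} {u : V} (hu : Descendant ρ lam w x u) : u ∈ weightSpace ρ x := by
  induction hu with
  | refl => exact hw.mem_weightSpace
  | act a b hab hu ih => exact act_rootVec_mem_weightSpace ρ ih a b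

/-- A root vector shifts the parity by exactly the parity of its root, so among descendants the
weight determines the parity. -/
theorem Descendant.mem_part (hw : IsHomogeneousHighestWeightVector ρ lam q w)
    {x : IntWeight m n} {u : V} (hu : Descendant ρ lam w x u) :
    u ∈ ρ.part (q + IntWeight.parity (x - lam)) := by
  induction hu with
  | refl => simpa using hw.mem_part
  | @act x u a b hab hu ih =>
    have h := ρ.act_mem (rootVec_mem a b) ih
    convert h using 2
    simp only [map_add, map_sub, parity_weight, CharTwo.sub_eq_add]
    ring

theorem Descendant.eq_or_height_lt {x : IntWeight m n} {u : V} (hu : Descendant ρ lam w x u) :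
    (x = lam ∧ u = w) ∨ IntWeight.height x < IntWeight.height lam := by
  induction hu with
  | refl => exact Or.inl ⟨rfl, rfl⟩
  | act a b hab hu ih =>
    right
    rw [map_add, map_sub]
    rcases ih with ⟨rfl, -⟩ | ih <;> omega

theorem act_lowering_mem_descendantSpan {a b : OspIndex k m n}
    (hab : IntWeight.height a.weight < IntWeight.height b.weight) {u : V}
    (hu : u ∈ descendantSpan ρ lam w) : ρ.act (rootVec a b) u ∈ descendantSpan ρ lam w := by
  induction hu using Submodule.span_induction with
  | mem u hu =>
    obtain ⟨x, hx⟩ := hu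
    exact Submodule.subset_span ⟨_, hx.act a b hab⟩
  | zero => simp
  | add u v _ _ hu hv => rw [map_add]; exact add_mem hu hv
  | smul c u _ hu => rw [map_smul]; exact Submodule.smul_mem _ c hu

/-- Induction on the number of lowering operators, for all `g` at once. On `w` itself a root vector
lowers, scales or kills. -/
theorem Descendant.act_mem_descendantSpan (hk : k ≤ 1)
    (hw : IsHomogeneousHighestWeightVector ρ lam q w)
    {x : IntWeight m n} {u : V} (hu : Descendant ρ lam w x u) (g : Osp k m n) :
    ρ.act g u ∈ descendantSpan ρ lam w := by
  induction hu generalizing g with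
  | refl =>
    have hg : g ∈ Submodule.span ℂ {x : Osp k m n | ∃ a b, x = rootVec a b} :=
      span_rootVec ▸ Submodule.mem_top
    induction hg using Submodule.span_induction with
    | mem g hg =>
      obtain ⟨a, b, rfl⟩ := hg
      rcases lt_trichotomy (IntWeight.height a.weight) (IntWeight.height b.weight) with h | h | h
      · exact act_lowering_mem_descendantSpan h mem_descendantSpan
      · obtain ⟨c, hc⟩ := exists_rootVec_eq_cartan hk h
        rw [hc, hw.mem_weightSpace]
        exact Submodule.smul_mem _ _ mem_descendantSpan
      · rw [hw.act_eq_zero a b h]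
        exact zero_mem _
    | zero => simp
    | add g g' _ _ h h' => rw [map_add]; exact add_mem h h'
    | smul c g _ h => rw [map_smul]; exact Submodule.smul_mem _ c h
  | @act x u a b hab hu ih =>
    have hg : g ∈ Submodule.span ℂ {x : Osp k m n | ∃ a b, x = rootVec a b} :=
      span_rootVec ▸ Submodule.mem_top
    induction hg using Submodule.span_induction with
    | mem g hg =>
      obtain ⟨c, d, rfl⟩ := hg
      have h := ρ.act_sbr (rootVec_mem c d) (rootVec_mem a b) u
      -- Move the new operator past the last lowering operator: the bracket and the operator both
      -- act on the shorter descendant `u`, where the induction hypothesis applies.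
      rw [sub_eq_iff_eq_add.1 h.symm]
      exact add_mem (ih _) (Submodule.smul_mem _ _ (act_lowering_mem_descendantSpan hab (ih _)))
    | zero => simp
    | add g g' _ _ h h' => rw [map_add]; exact add_mem h h'
    | smul c g _ h => rw [map_smul]; exact Submodule.smul_mem _ c h

/-- The span of the descendants of a highest weight vector is a submodule. -/
theorem act_mem_descendantSpan (hk : k ≤ 1) (hw : IsHomogeneousHighestWeightVector ρ lam q w)
    (g : Osp k m n) {u : V} (hu : u ∈ descendantSpan ρ lam w) :
    ρ.act g u ∈ descendantSpan ρ lam w := by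
  induction hu using Submodule.span_induction with
  | mem u hu =>
    obtain ⟨x, hx⟩ := hu
    exact hx.act_mem_descendantSpan hk hw g
  | zero => simp
  | add u v _ _ hu hv => rw [map_add]; exact add_mem hu hv
  | smul c u _ hu => rw [map_smul]; exact Submodule.smul_mem _ c hu

theorem proj_mem_descendantSpan (hw : IsHomogeneousHighestWeightVector ρ lam q w)
    (i : ZMod 2) {u : V} (hu : u ∈ descendantSpan ρ lam w) :
    ρ.proj i u ∈ descendantSpan ρ lam w := by
  induction hu using Submodule.span_induction with
  | mem u hu =>
    obtain ⟨x, hx⟩ := hu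
    rw [ρ.proj_of_mem (hx.mem_part hw)]
    split_ifs
    · exact Submodule.subset_span ⟨x, hx⟩
    · exact zero_mem _
  | zero => simp
  | add u v _ _ hu hv => rw [map_add]; exact add_mem hu hv
  | smul c u _ hu => rw [map_smul]; exact Submodule.smul_mem _ c hu

/-- In a highest weight module, the vectors of at least the highest height are the multiples of
the highest weight vector. -/
theorem exists_eq_smul_of_mem_heightSpace (hw : IsHomogeneousHighestWeightVector ρ lam q w)
    {u : V} (hu : u ∈ descendantSpan ρ lam w) {c : ℤ} (hc : IntWeight.height lam ≤ c)
    (huc : u ∈ heightSpace ρ (c : ℂ)) : ∃ t : ℂ, u = t • w := by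
  have hind := (Module.End.eigenspaces_iSupIndep
    (ρ.act (cartan k IntWeight.heightCoord))) (c : ℂ)
  set L : Submodule ℂ V := ⨆ (j : ℂ) (_ : j ≠ c), heightSpace ρ j with hL
  have hle : ∀ {j : ℂ}, j ≠ c → heightSpace ρ j ≤ L := fun {j} hj => le_iSup₂_of_le j hj le_rfl
  have hlow : ∀ {x : IntWeight m n} {u : V}, u ∈ weightSpace ρ x → IntWeight.height x < c →
      u ∈ L := fun hu hx => hle (by exact_mod_cast hx.ne) (mem_heightSpace hu)
  -- Every descendant other than `w` has height below that of `lam`, hence different from `c`, so it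
  -- lies in the sum `L` of the other eigenspaces.
  have hdec : ∃ t : ℂ, u - t • w ∈ L := by
    clear huc
    induction hu using Submodule.span_induction with
    | mem u hu =>
      obtain ⟨x, hx⟩ := hu
      rcases hx.eq_or_height_lt with ⟨-, rfl⟩ | h
      · exact ⟨1, by simp⟩
      · exact ⟨0, by simpa using hlow (hx.mem_weightSpace hw) (h.trans_le hc)⟩
    | zero => exact ⟨0, by simp⟩
    | add u v _ _ hu hv =>
      obtain ⟨s, hs⟩ := hu
      obtain ⟨t, ht⟩ := hv
      refine ⟨s + t, ?_⟩
      convert add_mem hs ht using 1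
      module
    | smul c u _ hu =>
      obtain ⟨s, hs⟩ := hu
      refine ⟨c * s, ?_⟩
      convert Submodule.smul_mem _ c hs using 1
      module
  obtain ⟨t, ht⟩ := hdec
  -- If `c` is the top height, `u - t • w` lies in the `c`-eigenspace and in `L`, so it is zero. If
  -- `c` is larger, `w` is in `L` too, and then `u` itself is zero.
  rcases hc.eq_or_lt with h | h
  · refine ⟨t, sub_eq_zero.1 (Submodule.disjoint_def.1 hind _ ?_ ht)⟩
    exact sub_mem huc (Submodule.smul_mem _ t (h ▸ mem_heightSpace hw.mem_weightSpace))
  · refine ⟨0, ?_⟩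
    rw [zero_smul]
    refine Submodule.disjoint_def.1 hind _ huc ?_
    have := add_mem ht (Submodule.smul_mem _ t (hlow hw.mem_weightSpace h))
    simpa using this

/-! ### Symmetry of the set of weights -/

section Reflection

attribute [local instance] LieRing.ofAssociativeRing

variable (ρ) in
/-- The weight string of an `sl₂`-triple of even root vectors is symmetric: one half. -/
theorem weightSpace_reflect_of_nat [FiniteDimensional ℂ V] {a b : OspIndex k m n}
    (hp : a.parity = b.parity) {H : CartanCoord m n} {c : ℂ} (hc : c ≠ 0)
    (hbr : LieSuperalgebra.sbr (rootVec a b) (rootVec b a) = c • cartan k H)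
    (hH : diagEntry H a - diagEntry H b = 2) {x : IntWeight m n} {N : ℕ}
    (hN : IntWeight.eval x H = N) (hx : weightSpace ρ x ≠ ⊥) :
    weightSpace ρ (x - N • (a.weight - b.weight)) ≠ ⊥ := by
  obtain ⟨u, hu, hu0⟩ := Submodule.exists_mem_ne_zero_of_ne_bot hx
  set h : Module.End ℂ V := ρ.act (cartan k H) with hh
  set e : Module.End ℂ V := ρ.act (rootVec a b) with he
  set f : Module.End ℂ V := c⁻¹ • ρ.act (rootVec b a) with hf
  -- An `IsSl2Triple` requires `h ≠ 0`. If `h = 0`, then `N = 0` and the reflected weight is `x`.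
  by_cases h0 : h = 0
  · have h1 := hu H
    rw [← hh, h0, LinearMap.zero_apply, hN, eq_comm, smul_eq_zero_iff_left hu0] at h1
    have h2 : N = 0 := by exact_mod_cast h1
    simpa [h2] using hx
  have hpp : a.parity + b.parity = 0 := by
    rw [hp]; generalize b.parity = y; revert y; decide
  have t : IsSl2Triple h e f := by
    refine ⟨h0, ?_, ?_, ?_⟩
    · ext v
      have h1 := ρ.act_sbr (rootVec_mem a b) (rootVec_mem b a) v
      rw [hbr, hpp, map_smul] at h1
      simp only [koszulSign, zero_ne_one, false_and, if_false, one_smul,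
        LinearMap.smul_apply] at h1
      rw [Ring.lie_def, LinearMap.sub_apply, Module.End.mul_apply, Module.End.mul_apply, hf,
        LinearMap.smul_apply, LinearMap.smul_apply, map_smul, ← smul_sub, he, ← h1, smul_smul,
        inv_mul_cancel₀ hc, one_smul]
    · ext v
      have h1 := act_cartan_act_rootVec ρ H a b v
      rw [hH] at h1
      rw [Ring.lie_def, LinearMap.sub_apply, Module.End.mul_apply, Module.End.mul_apply, he, hh, h1,
        add_sub_cancel_right, LinearMap.smul_apply, two_smul, two_smul]
    · ext v
      have h1 := act_cartan_act_rootVec ρ H b a v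
      rw [← neg_sub, hH] at h1
      rw [Ring.lie_def, LinearMap.sub_apply, Module.End.mul_apply, Module.End.mul_apply, hf, hh,
        LinearMap.smul_apply, LinearMap.smul_apply, map_smul, h1]
      simp only [LinearMap.neg_apply, LinearMap.smul_apply]
      module
  have hepow : ∀ p : ℕ, (e ^ p) u ∈ weightSpace ρ (x + p • (a.weight - b.weight)) := by
    intro p
    induction p with
    | zero => simpa using hu
    | succ p ih =>
      rw [pow_succ', Module.End.mul_apply, succ_nsmul, ← add_assoc]
      exact act_rootVec_mem_weightSpace ρ ih a b
  have hev : ∀ p : ℕ, h ((e ^ p) u) = ((N : ℂ) + 2 * p) • (e ^ p) u := by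
    intro p
    rw [hh, hepow p H, map_add, map_nsmul, Pi.add_apply, Pi.smul_apply, map_sub, Pi.sub_apply,
      eval_weight, eval_weight, hH, hN, nsmul_eq_mul, mul_comm 2]
  -- Otherwise `h` would have the infinitely many eigenvalues `N + 2p`.
  have hnil : ∃ p : ℕ, (e ^ p) u = 0 := by
    by_contra! hne
    have hfin := Module.End.finite_hasEigenvalue h
    refine Set.infinite_of_injective_forall_mem (f := fun p : ℕ => (N : ℂ) + 2 * p)
      (fun p p' hpp' => by simpa using hpp') (fun p => ?_) hfin
    exact Module.End.hasEigenvalue_of_hasEigenvector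
      ⟨Module.End.mem_eigenspace_iff.2 (hev p), hne p⟩
  obtain ⟨p, hp1, hp2⟩ := Nat.exists_not_and_succ_of_not_zero_of_exists
    (p := fun p => (e ^ p) u = 0) (by simpa using hu0) hnil
  have P : t.HasPrimitiveVectorWith ((e ^ p) u) ((N : ℂ) + 2 * p) := by
    refine ⟨hp1, hev p, ?_⟩
    rw [pow_succ', Module.End.mul_apply] at hp2
    exact hp2
  -- Applying `e` to the `(j+1)`-st lowering gives `(j+1)(N + 2p - j)` times the `j`-th, which is
  -- non-zero up to `j = N + 2p - 1`.
  have hfne : ∀ j : ℕ, j ≤ N + 2 * p →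
      ((LieModule.toEnd ℂ (Module.End ℂ V) V f) ^ j) ((e ^ p) u) ≠ 0 := by
    intro j
    induction j with
    | zero => intro _; simpa using hp1
    | succ j ih =>
      intro hj h1
      have h2 := P.lie_e_pow_succ_toEnd_f j
      rw [h1, lie_zero, eq_comm, smul_eq_zero_iff_left (ih (by omega)), mul_eq_zero] at h2
      rcases h2 with h2 | h2
      · exact Nat.cast_add_one_ne_zero j h2
      · have : N + 2 * p = j := by exact_mod_cast sub_eq_zero.1 h2
        omega
  have hfpow : ∀ j : ℕ, ((LieModule.toEnd ℂ (Module.End ℂ V) V f) ^ j) ((e ^ p) u) ∈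
      weightSpace ρ (x + p • (a.weight - b.weight) + j • (b.weight - a.weight)) := by
    intro j
    induction j with
    | zero => simpa using hepow p
    | succ j ih =>
      rw [pow_succ', Module.End.mul_apply, succ_nsmul, ← add_assoc]
      exact Submodule.smul_mem _ _ (act_rootVec_mem_weightSpace ρ ih b a)
  -- Lowering undoes the `p` raisings and then takes `N` further steps; `p + N ≤ N + 2p` keeps the
  -- vector non-zero.
  have h1 := hfpow (p + N)
  have h2 : x + p • (a.weight - b.weight) + (p + N) • (b.weight - a.weight) =
      x - N • (a.weight - b.weight) := by
    rw [add_nsmul, ← neg_sub a.weight b.weight]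
    module
  rw [h2] at h1
  exact Submodule.ne_bot_iff _ |>.2 ⟨_, h1, hfne (p + N) (by omega)⟩

end Reflection

variable (ρ) in
/-- The set of weights is stable under the reflection of an `sl₂`-triple of even root vectors. -/
theorem weightSpace_reflect [FiniteDimensional ℂ V] {a b : OspIndex k m n}
    (hp : a.parity = b.parity) {H : CartanCoord m n} {c : ℂ} (hc : c ≠ 0)
    (hbr : LieSuperalgebra.sbr (rootVec a b) (rootVec b a) = c • cartan k H)
    (hH : diagEntry H a - diagEntry H b = 2) {x : IntWeight m n} {N : ℤ}
    (hN : IntWeight.eval x H = N) (hx : weightSpace ρ x ≠ ⊥) :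
    weightSpace ρ (x - N • (a.weight - b.weight)) ≠ ⊥ := by
  obtain ⟨l, rfl | rfl⟩ := N.eq_nat_or_neg
  · rw [natCast_zsmul]
    exact weightSpace_reflect_of_nat ρ hp hc hbr hH (by simpa using hN) hx
  · have hneg : ∀ y : OspIndex k m n, diagEntry (-H) y = -diagEntry H y := fun y => by
      rw [← eval_weight, ← eval_weight, IntWeight.eval_neg_right]
    -- For a negative value, exchange the roles of the two root vectors, which negates the coroot.
    have := weightSpace_reflect_of_nat ρ (a := b) (b := a) (H := -H) hp.symm hc
      (by rw [sbr_rootVec_neg hp, hbr, cartan_neg, smul_neg])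
      (by rw [hneg, hneg]; linear_combination hH)
      (x := x) (N := l) (by rw [IntWeight.eval_neg_right, hN]; simp) hx
    convert this using 2
    rw [neg_smul, natCast_zsmul, ← smul_neg, neg_sub]

/-! ### Sign changes of the coordinates of a weight -/

theorem eval_single_left (x : IntWeight m n) (i : Fin n) (c : ℂ) :
    IntWeight.eval x (Pi.single i c, 0) = x.1 i * c := by
  simp [IntWeight.eval_apply, Pi.single_apply]

theorem eval_single_right (x : IntWeight m n) (i : Fin m) (c : ℂ) :
    IntWeight.eval x (0, Pi.single i c) = x.2 i * c := by
  simp [IntWeight.eval_apply, Pi.single_apply]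

theorem eval_single_add_single (x : IntWeight m n) (i j : Fin m) :
    IntWeight.eval x (0, Pi.single i 1 + Pi.single j 1) = x.2 i + x.2 j := by
  simp [IntWeight.eval_apply, Pi.single_apply, mul_add, Finset.sum_add_distrib]

theorem eval_single_sub_single (x : IntWeight m n) (i j : Fin m) :
    IntWeight.eval x (0, Pi.single i 1 - Pi.single j 1) = x.2 i - x.2 j := by
  simp [IntWeight.eval_apply, Pi.single_apply, mul_sub, Finset.sum_sub_distrib]

/-- The integral weight with the signs of the coordinates in `S` and `T` changed. -/
def flip (S : Finset (Fin n)) (T : Finset (Fin m)) (x : IntWeight m n) : IntWeight m n :=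
  (fun i => if i ∈ S then -x.1 i else x.1 i, fun j => if j ∈ T then -x.2 j else x.2 j)

theorem flip_insert_left {S : Finset (Fin n)} (T : Finset (Fin m)) (x : IntWeight m n) {i : Fin n}
    (hi : i ∉ S) : flip (insert i S) T x = flip S T x -
      x.1 i • (weight (k := k) (del i) - weight (k := k) (delBar i)) := by
  refine Prod.ext (funext fun j => ?_) (funext fun j => ?_)
  · by_cases hj : j = i
    · subst hj
      simp [flip, weight, hi]
    · simp [flip, weight, hj]
  · simp [flip, weight]

theorem flip_insert_right (S : Finset (Fin n)) {T : Finset (Fin m)} (x : IntWeight m n) {i : Fin m}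
    (hi : i ∉ T) : flip S (insert i T) x = flip S T x -
      (2 * x.2 i) • weight (k := k) (eps i) := by
  refine Prod.ext (funext fun j => ?_) (funext fun j => ?_)
  · simp [flip, weight]
  · by_cases hj : j = i
    · subst hj
      simp [flip, weight, hi]
      ring
    · simp [flip, weight, hj]

/-- The reflection in the root `2δ_i` changes the sign of the `i`-th coordinate alone; it is
available for every `k`. -/
theorem weightSpace_flip_left [FiniteDimensional ℂ V] {x : IntWeight m n}
    (hx : weightSpace ρ x ≠ ⊥) (S : Finset (Fin n)) : weightSpace ρ (flip S ∅ x) ≠ ⊥ := by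
  induction S using Finset.induction_on with
  | empty => simpa [flip] using hx
  | insert i S hi ih =>
    rw [flip_insert_left (k := k) ∅ x hi]
    refine weightSpace_reflect ρ (a := del i) (b := delBar i) rfl (c := 4) (by norm_num)
      (sbr_rootVec_del i) ?_ ?_ ih
    · simp [diagEntry]; norm_num
    · simp [eval_single_left, flip, hi]

/-- A zero weight vector `z` of the natural module provides the roots `ε_i`, whose reflections
change single signs. -/
theorem weightSpace_flip_right_of_fin [FiniteDimensional ℂ V] (z : Fin k)
    {S : Finset (Fin n)} {x : IntWeight m n} (hx : weightSpace ρ (flip S ∅ x) ≠ ⊥)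
    (T : Finset (Fin m)) : weightSpace ρ (flip S T x) ≠ ⊥ := by
  induction T using Finset.induction_on with
  | empty => exact hx
  | insert i T hi ih =>
    have := weightSpace_reflect ρ (a := eps i) (b := zero z) rfl (inv_ne_zero two_ne_zero)
      (sbr_rootVec_eps_zero i z)
      (x := flip S T x) (N := 2 * x.2 i)
      (by simp [diagEntry]) (by simp [eval_single_right, flip, hi, mul_comm]) ih
    rw [flip_insert_right (k := k) S x hi]
    simpa [weight] using this

/-- Without the roots `ε_i`, signs change in pairs: reflecting in `ε_i - ε_j` swaps two coordinates,
and reflecting in `ε_i + ε_j` swaps them back with both signs changed. -/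
theorem weightSpace_flip_right_of_even [FiniteDimensional ℂ V]
    {S : Finset (Fin n)} {x : IntWeight m n} (hx : weightSpace ρ (flip S ∅ x) ≠ ⊥) (l : ℕ)
    (T : Finset (Fin m)) (hT : T.card = 2 * l) : weightSpace ρ (flip S T x) ≠ ⊥ := by
  induction l generalizing T with
  | zero =>
    obtain rfl := Finset.card_eq_zero.1 (hT.trans (mul_zero 2))
    exact hx
  | succ l ih =>
    obtain ⟨i, T', hi, rfl, hT'⟩ := Finset.card_eq_succ.1 (show T.card = 2 * l + 1 + 1 by omega)
    obtain ⟨j, T, hj, rfl, hT''⟩ := Finset.card_eq_succ.1 hT'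
    have hij : i ≠ j := fun h => hi (h ▸ Finset.mem_insert_self _ _)
    have hi' : i ∉ T := fun h => hi (Finset.mem_insert_of_mem h)
    have h1 := weightSpace_reflect ρ (a := eps i) (b := eps j) rfl one_ne_zero
      (sbr_rootVec_eps_eps hij)
      (x := flip S T x) (N := x.2 i - x.2 j)
      (by simp [diagEntry, hij, hij.symm]; norm_num)
      (by simp [eval_single_sub_single, flip, hi', hj]) (ih T hT'')
    have h2 := weightSpace_reflect ρ (a := eps i) (b := epsBar j) rfl one_ne_zero
      (sbr_rootVec_eps_epsBar hij)
      (N := x.2 i + x.2 j)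
      (by simp [diagEntry, hij, hij.symm]; norm_num)
      (by
        simp [eval_single_add_single, flip, hi', hj, weight, hij, hij.symm]
        ring) h1
    rw [flip_insert_right (k := k) S x hi, flip_insert_right (k := k) S x hj]
    convert h2 using 2
    simp only [weight]
    module

/-- The set of weights is stable under `-1`. -/
theorem weightSpace_neg [FiniteDimensional ℂ V] (hk : k = 1 ∨ Even m) {x : IntWeight m n}
    (hx : weightSpace ρ x ≠ ⊥) : weightSpace ρ (-x) ≠ ⊥ := by
  have h : -x = flip Finset.univ Finset.univ x := by ext <;> simp [flip]
  rw [h]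
  have h1 := weightSpace_flip_left hx Finset.univ
  rcases hk with rfl | ⟨l, hl⟩
  · exact weightSpace_flip_right_of_fin 0 h1 _
  · exact weightSpace_flip_right_of_even h1 l _ (by simp; omega)

end Osp


/-! ### Direct sums of modules and self-contragredience -/

namespace SuperRep

variable {𝔤 : Type*} [AddCommGroup 𝔤] [Module ℂ 𝔤] [LieSuperalgebra 𝔤]
variable {V : Type*} [AddCommGroup V] [Module ℂ V]
variable {W : Type*} [AddCommGroup W] [Module ℂ W]

/-- The direct sum of two modules. -/
def prod (ρ : SuperRep 𝔤 V) (σ : SuperRep 𝔤 W) : SuperRep 𝔤 (V × W) where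
  part i := (ρ.part i).prod (σ.part i)
  isCompl_part := by
    constructor
    · rw [disjoint_iff, Submodule.prod_inf_prod, ρ.isCompl_part.inf_eq_bot,
        σ.isCompl_part.inf_eq_bot, Submodule.prod_bot]
    · rw [codisjoint_iff, Submodule.prod_sup_prod, ρ.isCompl_part.sup_eq_top,
        σ.isCompl_part.sup_eq_top, Submodule.prod_top]
  act :=
    { toFun := fun x => (ρ.act x).prodMap (σ.act x)
      map_add' := fun x y => by ext <;> simp
      map_smul' := fun c x => by ext <;> simp }
  act_mem hx hv := ⟨ρ.act_mem hx hv.1, σ.act_mem hx hv.2⟩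
  act_sbr hx hy v := Prod.ext (ρ.act_sbr hx hy v.1) (σ.act_sbr hx hy v.2)

theorem prod_act (ρ : SuperRep 𝔤 V) (σ : SuperRep 𝔤 W) (x : 𝔤) (v : V × W) :
    (ρ.prod σ).act x v = (ρ.act x v.1, σ.act x v.2) := rfl

theorem prod_proj (ρ : SuperRep 𝔤 V) (σ : SuperRep 𝔤 W) (i : ZMod 2) (v : V × W) :
    (ρ.prod σ).proj i v = (ρ.proj i v.1, σ.proj i v.2) := by
  have key : ∀ j, ∀ u ∈ (ρ.prod σ).part j,
      (ρ.prod σ).proj i u = (ρ.proj i u.1, σ.proj i u.2) := by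
    intro j u hu
    rw [(ρ.prod σ).proj_of_mem hu, ρ.proj_of_mem hu.1, σ.proj_of_mem hu.2]
    split_ifs <;> rfl
  rw [← (ρ.prod σ).sum_proj v, map_add, key 0 _ ((ρ.prod σ).proj_mem 0 v),
    key 1 _ ((ρ.prod σ).proj_mem 1 v)]
  simp

theorem act_proj (ρ : SuperRep 𝔤 V) {j : ZMod 2} {x : 𝔤}
    (hx : x ∈ LieSuperalgebra.toSuperSpace.part j) (i : ZMod 2) (v : V) :
    ρ.act x (ρ.proj i v) = ρ.proj (j + i) (ρ.act x v) := by
  conv_rhs => rw [← ρ.sum_proj v]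
  rw [map_add, map_add, ρ.proj_of_mem (ρ.act_mem hx (ρ.proj_mem 0 v)),
    ρ.proj_of_mem (ρ.act_mem hx (ρ.proj_mem 1 v))]
  rcases zmod2_cases i with rfl | rfl <;> simp

/-- A graded submodule of `V ⊕ W` that projects onto `V` and meets `V` trivially is the graph of
an isomorphism if `V` and `W` have the same dimension. -/
theorem isIsomorphic_of_submodule_prod [FiniteDimensional ℂ V] [FiniteDimensional ℂ W]
    (ρ : SuperRep 𝔤 V) (σ : SuperRep 𝔤 W) (hdim : Module.finrank ℂ V = Module.finrank ℂ W)
    (N : Submodule ℂ (V × W)) (hproj : ∀ i, ∀ v ∈ N, (ρ.prod σ).proj i v ∈ N)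
    (hact : ∀ x, ∀ v ∈ N, (ρ.prod σ).act x v ∈ N) (hsurj : ∀ v, ∃ w, (v, w) ∈ N)
    (hinj : ∀ v, (v, (0 : W)) ∈ N → v = 0) : ρ.IsIsomorphic σ := by
  set p₁ : N →ₗ[ℂ] V := LinearMap.fst ℂ V W ∘ₗ N.subtype with hp₁
  set p₂ : N →ₗ[ℂ] W := LinearMap.snd ℂ V W ∘ₗ N.subtype with hp₂
  have h₁ : Function.Surjective p₁ := fun v => by
    obtain ⟨w, hw⟩ := hsurj v
    exact ⟨⟨(v, w), hw⟩, rfl⟩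
  have h₂ : Function.Injective p₂ := by
    rw [injective_iff_map_eq_zero]
    rintro ⟨⟨v, w⟩, hN⟩ h
    replace h : w = 0 := h
    subst h
    obtain rfl := hinj v hN
    rfl
  -- Now `dim V ≤ dim N ≤ dim W = dim V`, so both projections are bijective and `N` is a graph.
  have hle := LinearMap.finrank_le_finrank_of_injective h₂
  have hge := LinearMap.finrank_le_finrank_of_surjective h₁
  have h₁' : Function.Injective p₁ :=
    (LinearMap.injective_iff_surjective_of_finrank_eq_finrank (by omega)).2 h₁
  have h₂' : Function.Surjective p₂ :=
    (LinearMap.injective_iff_surjective_of_finrank_eq_finrank (by omega)).1 h₂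
  set e₁ := LinearEquiv.ofBijective p₁ ⟨h₁', h₁⟩ with he₁
  set e₂ := LinearEquiv.ofBijective p₂ ⟨h₂, h₂'⟩ with he₂
  have hmem : ∀ v, (v, (e₁.symm.trans e₂) v) ∈ N := fun v => by
    have h : (e₁.symm v).1.1 = v := e₁.apply_symm_apply v
    have h' := (e₁.symm v).2
    convert h' using 1
    exact Prod.ext h.symm rfl
  have huniq : ∀ v w, (v, w) ∈ N → (e₁.symm.trans e₂) v = w := fun v w hN => by
    have h : (⟨(v, w), hN⟩ : N) = ⟨_, hmem v⟩ := h₁' rfl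
    exact (congrArg (fun y : N => y.1.2) h).symm
  refine ⟨e₁.symm.trans e₂, fun i v hv => ?_, fun x v => huniq _ _ (hact x _ (hmem v))⟩
  have h := hproj i _ (hmem v)
  rw [prod_proj] at h
  simp only [ρ.proj_of_mem hv, if_true] at h
  rw [huniq _ _ h]
  exact σ.proj_mem i _

end SuperRep

/-! ### The highest weight vector of the dual module and the isomorphism -/

namespace Osp

open OspIndex

variable {k m n : ℕ} {V : Type*} [AddCommGroup V] [Module ℂ V] {ρ : SuperRep (Osp k m n) V}

theorem IsIntegral.exists_eval {lam : Weight m n} (h : IsIntegral lam) :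
    ∃ x : IntWeight m n, ∀ c, lam c = IntWeight.eval x c := by
  induction h using Submodule.span_induction with
  | mem lam h =>
    rcases h with ⟨i, rfl⟩ | ⟨j, rfl⟩
    · exact ⟨(Pi.single i 1, 0), fun c => by simp [IntWeight.eval_apply, wδ, Pi.single_apply]⟩
    · exact ⟨(0, Pi.single j 1), fun c => by simp [IntWeight.eval_apply, wε, Pi.single_apply]⟩
  | zero => exact ⟨0, fun c => by simp⟩
  | add a b _ _ ha hb =>
    obtain ⟨x, hx⟩ := ha
    obtain ⟨y, hy⟩ := hb
    exact ⟨x + y, fun c => by simp [hx, hy]⟩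
  | smul z a _ ha =>
    obtain ⟨x, hx⟩ := ha
    exact ⟨z • x, fun c => by rw [LinearMap.smul_apply, hx, map_zsmul, Pi.smul_apply]⟩

/-- Cartan elements and root vectors are homogeneous, so both graded components of a highest weight
vector satisfy the same equations, and one of them is non-zero. -/
theorem HasIntegralHighestWeight.exists_homogeneous (hk : k ≤ 1) (h : HasIntegralHighestWeight ρ) :
    ∃ (lam : IntWeight m n) (q : ZMod 2) (w : V), w ≠ 0 ∧
      IsHomogeneousHighestWeightVector ρ lam q w := by
  obtain ⟨lam, v, hlam, hv0, hcart, hkill⟩ := h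
  obtain ⟨x, hx⟩ := hlam.exists_eval
  have key : ∀ q, IsHomogeneousHighestWeightVector ρ x q (ρ.proj q v) := by
    refine fun q => ⟨fun h => ?_, ρ.proj_mem q v, fun a b hab => ?_⟩
    · rw [ρ.act_proj (cartan_mem h), zero_add, hcart, map_smul, hx]
    · rw [ρ.act_proj (rootVec_mem a b)]
      rcases rootVec_eq_zero_or_isPositiveRoot hk hab with h0 | ⟨α, hα, hr⟩
      · simp [h0]
      · rw [hkill α _ hα hr, map_zero]
  by_cases h0 : ρ.proj 0 v = 0
  · refine ⟨x, 1, _, fun h1 => hv0 ?_, key 1⟩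
    rw [← ρ.sum_proj v, h0, h1, add_zero]
  · exact ⟨x, 0, _, h0, key 0⟩

theorem weight_eq_of_ne_zero {x y : IntWeight m n} {v : V} (hv : v ≠ 0)
    (hx : v ∈ weightSpace ρ x) (hy : v ∈ weightSpace ρ y) : x = y :=
  IntWeight.eval_injective (funext fun h => smul_left_injective ℂ hv ((hx h).symm.trans (hy h)))

/-- If the highest weight is `lam` and the set of weights is symmetric, then the dual module has
a highest weight vector of weight `lam`. -/
theorem exists_dual_highestWeightVector [FiniteDimensional ℂ V] (hm : k = 1 ∨ Even m)
    {lam : IntWeight m n} {q : ZMod 2} {w : V} (hw0 : w ≠ 0)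
    (hw : IsHomogeneousHighestWeightVector ρ lam q w) (htop : descendantSpan ρ lam w = ⊤) :
    ∃ f : Module.Dual ℂ V, f ≠ 0 ∧
      IsHomogeneousHighestWeightVector ρ.contragredient lam q f := by
  have habove : ∀ {x u}, u ∈ weightSpace ρ x → u ≠ 0 →
      x = lam ∨ IntWeight.height x < IntWeight.height lam := by
    intro x u hu hu0
    by_contra! h
    obtain ⟨t, rfl⟩ := exists_eq_smul_of_mem_heightSpace hw (htop ▸ Submodule.mem_top) h.2
      (mem_heightSpace hu)
    exact h.1 (weight_eq_of_ne_zero hu0 hu (Submodule.smul_mem _ t hw.mem_weightSpace))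
  -- Stability of the weights under `-1` turns the statement that `lam` is highest into the
  -- statement that `-lam` is lowest.
  have hbelow : ∀ {x u}, u ∈ weightSpace ρ x → u ≠ 0 →
      x = -lam ∨ -IntWeight.height lam < IntWeight.height x := by
    intro x u hu hu0
    obtain ⟨u', hu', hu0'⟩ := Submodule.exists_mem_ne_zero_of_ne_bot
      (weightSpace_neg hm ((Submodule.ne_bot_iff _).2 ⟨u, hu, hu0⟩))
    rcases habove hu' hu0' with h | h
    · exact Or.inl (by rw [← h, neg_neg])
    · right
      rw [map_neg] at h
      omega
  obtain ⟨u, hu, hu0⟩ := Submodule.exists_mem_ne_zero_of_ne_bot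
    (weightSpace_neg hm ((Submodule.ne_bot_iff _).2 ⟨w, hw.mem_weightSpace, hw0⟩))
  set c : ℂ := ((IntWeight.height (-lam) : ℤ) : ℂ) with hc
  set R : Submodule ℂ V := ⨆ (j : ℂ) (_ : j ≠ c), heightSpace ρ j with hR
  have huR : u ∉ R := fun h => hu0 (Submodule.disjoint_def.1
    (Module.End.eigenspaces_iSupIndep (ρ.act (cartan k IntWeight.heightCoord)) c) u
    (mem_heightSpace hu) h)
  -- The required functional: non-zero on a vector of weight `-lam`, zero on every other height
  -- eigenspace.
  obtain ⟨f, hfu, hfR⟩ := Submodule.exists_le_ker_of_notMem huR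
  have hf : ∀ {x z}, z ∈ weightSpace ρ x → x ≠ -lam → f z = 0 := by
    intro x z hz hx
    by_cases hz0 : z = 0
    · rw [hz0, map_zero]
    have h1 := (hbelow hz hz0).resolve_left hx
    refine hfR ((le_iSup₂_of_le (f := fun j (_ : j ≠ c) => heightSpace ρ j)
      (IntWeight.height x : ℂ) ?_ le_rfl) (mem_heightSpace hz))
    rw [hc, map_neg]
    exact_mod_cast h1.ne'
  have hext : ∀ g g' : Module.Dual ℂ V,
      (∀ x z, Descendant ρ lam w x z → g z = g' z) → g = g' := fun g g' h =>
    LinearMap.ext_on (s := {z | ∃ x, Descendant ρ lam w x z}) htop fun z ⟨x, hz⟩ => h x z hz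
  have hpar : f ∈ (ρ.part (q + 1)).dualAnnihilator := by
    have h0 : f ∘ₗ ρ.proj (q + 1) = 0 := by
      refine hext _ _ fun x z hz => ?_
      rw [LinearMap.comp_apply, LinearMap.zero_apply, ρ.proj_of_mem (hz.mem_part hw)]
      split_ifs with h
      -- A descendant of weight `-lam` has parity `q + parity (-2 lam) = q`, so it cannot lie in the
      -- part of degree `q + 1`.
      · refine hf (hz.mem_weightSpace hw) fun hx => ?_
        rw [add_right_inj, hx, map_sub, map_neg, CharTwo.neg_eq, sub_self] at h
        exact one_ne_zero h
      · exact map_zero f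
    rw [Submodule.mem_dualAnnihilator]
    intro z hz
    have := LinearMap.congr_fun h0 z
    rwa [LinearMap.comp_apply, ρ.proj_of_mem hz, if_pos rfl] at this
  refine ⟨f, fun h => hfu (by rw [h, LinearMap.zero_apply]), fun h => ?_, hpar, fun a b hab => ?_⟩
  · refine hext _ _ fun x z hz => ?_
    have hz' := hz.mem_weightSpace hw
    change ρ.dualAct (cartan k h) f z = _
    rw [ρ.dualAct_apply (cartan_mem h) hpar, hz' h, map_smul, LinearMap.smul_apply]
    by_cases hx : x = -lam
    · subst hx
      simp [koszulSign]
    · rw [hf hz' hx]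
      simp
  · refine hext _ _ fun x z hz => ?_
    have hz' := hz.mem_weightSpace hw
    change ρ.dualAct (rootVec a b) f z = 0
    rw [ρ.dualAct_apply (rootVec_mem a b) hpar, neg_eq_zero]
    by_cases hz0 : z = 0
    · simp [hz0]
    rw [hf (act_rootVec_mem_weightSpace ρ hz' a b), mul_zero]
    -- Otherwise `x` would be `-lam` minus a weight of positive height, hence a weight strictly
    -- below the lowest one.
    intro hx
    have h1 := congrArg IntWeight.height hx
    rw [map_add, map_sub, map_neg] at h1
    rcases hbelow hz' hz0 with rfl | h2
    · rw [map_neg] at h1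
      omega
    · omega

theorem isSelfContragredient [FiniteDimensional ℂ V] (hk : k ≤ 1) (hm : k = 1 ∨ Even m)
    (hirr : ρ.IsIrreducible) (hlam : HasIntegralHighestWeight ρ) : ρ.IsSelfContragredient := by
  obtain ⟨lam, q, w, hw0, hw⟩ := hlam.exists_homogeneous hk
  have htop : descendantSpan ρ lam w = ⊤ :=
    (hirr.2 _ (fun i v => proj_mem_descendantSpan hw i)
      (fun x v => act_mem_descendantSpan hk hw x)).resolve_left
      ((Submodule.ne_bot_iff _).2 ⟨w, mem_descendantSpan, hw0⟩)
  obtain ⟨f, hf0, hf⟩ := exists_dual_highestWeightVector hm hw0 hw htop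
  have hp : IsHomogeneousHighestWeightVector (ρ.prod ρ.contragredient) lam q (w, f) :=
    ⟨fun h => Prod.ext (hw.mem_weightSpace h) (hf.mem_weightSpace h),
      ⟨hw.mem_part, hf.mem_part⟩,
      fun a b hab => Prod.ext (hw.act_eq_zero a b hab) (hf.act_eq_zero a b hab)⟩
  set N := descendantSpan (ρ.prod ρ.contragredient) lam (w, f) with hN
  have hNproj : ∀ i, ∀ v ∈ N, (ρ.prod ρ.contragredient).proj i v ∈ N := fun i v =>
    proj_mem_descendantSpan hp i
  have hNact : ∀ x, ∀ v ∈ N, (ρ.prod ρ.contragredient).act x v ∈ N := fun x v =>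
    act_mem_descendantSpan hk hp x
  refine SuperRep.isIsomorphic_of_submodule_prod _ _ Subspace.dual_finrank_eq.symm N hNproj hNact
    ?_ ?_
  -- The projection of `N` to `V` is a graded submodule containing `w`, so it is everything.
  · have h := (hirr.2 (N.map (LinearMap.fst ℂ V _)) ?_ ?_).resolve_left
      ((Submodule.ne_bot_iff _).2 ⟨w, ⟨(w, f), mem_descendantSpan, rfl⟩, hw0⟩)
    · intro v
      have hv : v ∈ N.map (LinearMap.fst ℂ V _) := h ▸ Submodule.mem_top
      obtain ⟨⟨v', g⟩, hvg, rfl⟩ := hv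
      exact ⟨g, hvg⟩
    · rintro i _ ⟨v, hv, rfl⟩
      exact ⟨_, hNproj i v hv, by rw [SuperRep.prod_proj]; rfl⟩
    · rintro x _ ⟨v, hv, rfl⟩
      exact ⟨_, hNact x v hv, rfl⟩
  · have h := (hirr.2 (N.comap (LinearMap.inl ℂ V _)) ?_ ?_).resolve_right ?_
    · intro v hv
      have : v ∈ N.comap (LinearMap.inl ℂ V _) := hv
      rwa [h, Submodule.mem_bot] at this
    · intro i v hv
      have := hNproj i _ hv
      rw [SuperRep.prod_proj] at this
      simpa using this
    · intro x v hv
      have := hNact x _ hv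
      rw [SuperRep.prod_act] at this
      simpa using this
    · intro h
      -- If `N` contained all of `V`, then `(w, 0)` would be a vector of top height in `N`, hence a
      -- multiple of `(w, f)`, which is impossible since `w` and `f` are both non-zero.
      have hw' : w ∈ N.comap (LinearMap.inl ℂ V _) := h ▸ Submodule.mem_top
      obtain ⟨t, ht⟩ := exists_eq_smul_of_mem_heightSpace hp hw' le_rfl
        (mem_heightSpace (x := lam) fun h => Prod.ext (hw.mem_weightSpace h) (by
          simp [SuperRep.prod_act]))
      have h1 : w = t • w := congrArg Prod.fst ht
      have h2 : 0 = t • f := congrArg Prod.snd ht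
      rcases smul_eq_zero.1 h2.symm with rfl | h3
      · exact hw0 (by simpa using h1)
      · exact hf0 h3

end Osp

end

theorem mainTheorem11 (m n : ℕ) :
    (∀ (V : Type*) [AddCommGroup V] [Module ℂ V] [FiniteDimensional ℂ V]
      (ρ : SuperRep (Osp 1 m n) V), ρ.IsIrreducible → Osp.HasIntegralHighestWeight ρ →
        ρ.IsSelfContragredient) ∧
    (Even m → ∀ (V : Type*) [AddCommGroup V] [Module ℂ V] [FiniteDimensional ℂ V]
      (ρ : SuperRep (Osp 0 m n) V), ρ.IsIrreducible → Osp.HasIntegralHighestWeight ρ →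
        ρ.IsSelfContragredient) :=
  ⟨fun _ _ _ _ _ h1 h2 => Osp.isSelfContragredient le_rfl (Or.inl rfl) h1 h2,
    fun hm _ _ _ _ _ h1 h2 => Osp.isSelfContragredient zero_le_one (Or.inr hm) h1 h2⟩
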